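/- **Central limit theorem with Berry–Esseen bound.** Let $X$ be a real random variable with mean $\mu=E(X)$ and finite, positive variance $\sigma^2=\mathrm{Var}(X)$, and let $X_1,X_2,\ldots$ be independent random variables on a common probability space, each with the same distribution as $X$. For $n\ge 1$ let $\bar X_n=\frac1n\sum_{i=1}^n X_i$ be the sample mean and let $$\bar Z_n=\frac{\bar X_n-E(\bar X_n)}{\sqrt{\mathrm{Var}(\bar X_n)}}$$ be the standardized sample mean. Then: 1. For every $n\ge1$, $\displaystyle \bar Z_n=\frac{\sum_{i=1}^n X_i-n\mu}{\sqrt{n\sigma^2}}$. 2. If $Z\sim N(0,1)$, then for every $z\in\mathbb R$ $$\lim_{n\to\infty}P(\bar Z_n\le z)=P(Z\le z)=\int_{-\infty}^z\frac1{\sqrt{2\pi}}\exp\left(-\frac{x^2}{2}\right)dx,$$ and $\bar Z_n\to Z$ in distribution as $n\to\infty$. 3. (Berry–Esseen) If $E\left(|X_1-E(X_1)|^3\right)<\infty$, then for every $n\ge1$ and every $z\in\mathbb R$ $$\left|P(\bar Z_n\le z)-\int_{-\infty}^z\frac1{\sqrt{2\pi}}\exp\left(-\frac{x^2}{2}\right)dx\right|\le\frac{0.77\,E\left(|X_1-E(X_1)|^3\right)}{(\mathrm{Var}(X_1))^{3/2}\sqrt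 n}.$$ -/

import Mathlib

open MeasureTheory ProbabilityTheory Filter Topology

noncomputable section

/-- The sample mean `(X₁ + ⋯ + Xₙ) / n` of the first `n` terms of a sequence of random variables;
the sequence is indexed from `0`, so `X 0, …, X (n - 1)` are the `n` sample variables. -/
def sampleMean {Ω : Type*} (X : ℕ → Ω → ℝ) (n : ℕ) (ω : Ω) : ℝ :=
  (∑ i ∈ Finset.range n, X i ω) / (n : ℝ)

/-- The standardized sample mean: the sample mean, centred at its expectation and divided by its
standard deviation. -/
def standardizedSampleMean {Ω : Type*} [MeasurableSpace Ω] (P : Measure Ω) (X : ℕ → Ω → ℝ)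
    (n : ℕ) (ω : Ω) : ℝ :=
  (sampleMean X n ω - ∫ ω', sampleMean X n ω' ∂P) / √(variance (sampleMean X n) P)

/-- The distribution function of the standard normal law, as the integral of its density. -/
def stdNormalCDF (z : ℝ) : ℝ :=
  ∫ x in Set.Iic z, 1 / √(2 * Real.pi) * Real.exp (-(x ^ 2) / 2)

end

namespace BerryEsseen

open Real Set
open scoped Interval

/-! ### Beurling's majorant of the Heaviside function -/

/-! The formula for the standardized mean is a computation of mean and variance, and the limit law
is the central limit theorem `tendstoInDistribution_inv_sqrt_mul_sum`, applied to the standardized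
variables; convergence at every z holds because the Gaussian has no atoms. The substance is the
constant 0.77.

Let S be the normalized sum, β the third absolute moment of a standardized summand and ε = β/√n. The
event S ≤ z is majorized by Beurling's function evaluated at T(z - S)/(2π)
(`indicator_Ici_le_beurling`). The Fourier transform of this majorant is supported in a bounded
interval apart from the constant 1/2, so taking expectations bounds P(S ≤ z) by 1/2 plus an integral
of the characteristic function of S over frequencies t = Tx with 0 < x < 1 (`measureReal_Iic_le`).
The normal distribution function has the inversion formula 1/2 + ∫ sin(zt) exp(-t²/2)/(πt) dt over t
> 0. Subtracting leaves two costs (`measureReal_Iic_le_stdNormalCDF_add`): a Gaussian one, √(π/2)/T,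
and a remainder measuring how far the characteristic function is from the Gaussian one at low
frequency and how large it is at high frequency.

Both are controlled by moments. Symmetrization gives |φ(s)|² ≤ 1 - s² + 0.4 β|s|³
(`sq_norm_charFun_le`), and a third-order Taylor bound with telescoping of nth powers controls the
difference (`norm_charFun_pow_sub_le`). With T = 5/(2ε), the frequency at which the decay estimate
degenerates, the Gaussian cost is at most 0.5014 ε and the remainder at most 0.2686 ε
(`integral_smoothingRemainder_le`), the latter by calculus for ε ≤ 1/5 and by verified integer
arithmetic for 1/5 ≤ ε < 0.71. For ε ≥ 0.71 the bound exceeds 0.5467, and Cantelli's inequality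
suffices. The opposite inequality follows by reflecting S to -S. -/

lemma two_mul_mul_one_sub_le_sin {x : ℝ} (h0 : 0 ≤ x) (h1 : x ≤ 1) :
    2 * (x * (1 - x)) ≤ sin (π * x) := by
  have hp := pi_pos
  rcases le_total x (1 / 2) with h | h
  · have := mul_le_sin (x := π * x) (by positivity) (by nlinarith)
    have h2 : 2 / π * (π * x) = 2 * x := by field_simp
    nlinarith
  · have := mul_le_sin (x := π * (1 - x)) (mul_nonneg hp.le (by linarith)) (by nlinarith)
    have h2 : 2 / π * (π * (1 - x)) = 2 * (1 - x) := by field_simp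
    have h3 : sin (π * (1 - x)) = sin (π * x) := by rw [mul_sub, mul_one, sin_pi_sub]
    nlinarith

lemma sin_pi_mul_pos {x : ℝ} (h0 : 0 < x) (h1 : x < 1) : 0 < sin (π * x) :=
  sin_pos_of_pos_of_lt_pi (mul_pos pi_pos h0) (by nlinarith [pi_pos])

/-- The pole of the cotangent at 0 is absorbed by y = O(x) and the one at 1 by the factor 1 - x; the
parabola 2x(1 - x) below the sine handles both at once. -/
lemma abs_one_sub_mul_cot_mul_le {x a y : ℝ} (h0 : 0 < x) (h1 : x < 1)
    (hy : |y| ≤ 2 * (a * x)) :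
    |(1 - x) * (cos (π * x) / sin (π * x)) * y| ≤ a := by
  have hs := sin_pi_mul_pos h0 h1
  have h2 := two_mul_mul_one_sub_le_sin h0.le h1.le
  have ha : 0 ≤ a := by
    have := abs_nonneg y
    by_contra h
    nlinarith
  rw [abs_mul, abs_mul, abs_div, abs_of_pos hs, abs_of_pos (by linarith : 0 < 1 - x)]
  calc (1 - x) * (|cos (π * x)| / sin (π * x)) * |y|
      ≤ (1 - x) * (1 / sin (π * x)) * (2 * (a * x)) := by
        have := abs_cos_le_one (π * x)
        have : 0 ≤ 1 - x := by linarith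
        gcongr
    _ = a * (2 * (x * (1 - x))) / sin (π * x) := by field_simp
    _ ≤ a := by
        rw [div_le_iff₀ hs]
        gcongr

lemma intervalIntegrable_one_sub_mul_cot_mul {f : ℝ → ℝ} (hf : Measurable f) {a : ℝ}
    (h : ∀ x, 0 < x → x < 1 → |f x| ≤ 2 * (a * x)) :
    IntervalIntegrable (fun x => (1 - x) * (cos (π * x) / sin (π * x)) * f x) volume 0 1 := by
  rw [intervalIntegrable_iff_integrableOn_Ioo_of_le zero_le_one]
  refine Measure.integrableOn_of_bounded (M := a) (by simp) ?_ ?_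
  · exact Measurable.aestronglyMeasurable (by fun_prop)
  · refine (ae_restrict_mem measurableSet_Ioo).mono fun x hx => ?_
    exact abs_one_sub_mul_cot_mul_le hx.1 hx.2 (h x hx.1 hx.2)

lemma abs_sin_two_pi_mul_le (u : ℝ) {x : ℝ} (h0 : 0 < x) :
    |sin (2 * π * u * x)| ≤ 2 * (π * |u| * x) := by
  refine abs_sin_le_abs.trans (le_of_eq ?_)
  rw [abs_mul, abs_mul, abs_of_pos two_pi_pos, abs_of_pos h0]
  ring

/-- The cosine transform of the triangle function `1 - x` on `[0, 1]`. -/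
noncomputable def fejerIntegral (u : ℝ) : ℝ := ∫ x in (0 : ℝ)..1, (1 - x) * cos (2 * π * u * x)

/-- The sine transform of `(1 - x) cot (π x)` on `[0, 1]`. -/
noncomputable def cotIntegral (u : ℝ) : ℝ :=
  ∫ x in (0 : ℝ)..1, (1 - x) * (cos (π * x) / sin (π * x)) * sin (2 * π * u * x)

lemma intervalIntegrable_cotIntegral (u : ℝ) : IntervalIntegrable
    (fun x => (1 - x) * (cos (π * x) / sin (π * x)) * sin (2 * π * u * x)) volume 0 1 :=
  intervalIntegrable_one_sub_mul_cot_mul (by fun_prop) fun _ h0 _ => abs_sin_two_pi_mul_le u h0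

lemma cos_two_pi_mul (u : ℝ) : cos (2 * π * u) = 1 - 2 * sin (π * u) ^ 2 := by
  rw [mul_assoc, cos_two_mul, cos_sq']; ring

lemma fejerIntegral_eq {u : ℝ} (hu : u ≠ 0) :
    fejerIntegral u = sin (π * u) ^ 2 / (2 * π ^ 2 * u ^ 2) := by
  have hp := pi_ne_zero
  have ha : 2 * π * u ≠ 0 := by positivity
  have h : ∀ x ∈ uIcc (0 : ℝ) 1, HasDerivAt
      (fun x => (1 - x) * sin (2 * π * u * x) / (2 * π * u) - cos (2 * π * u * x) / (2 * π * u) ^ 2)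
      ((1 - x) * cos (2 * π * u * x)) x := by
    intro x _
    have h1 : HasDerivAt (fun x => 2 * π * u * x) (2 * π * u) x := by
      simpa using (hasDerivAt_id x).const_mul (2 * π * u)
    have h2 : HasDerivAt (fun x : ℝ => 1 - x) (-1) x := by
      simpa using (hasDerivAt_id x).const_sub 1
    convert! ((h2.mul h1.sin).div_const (2 * π * u)).sub (h1.cos.div_const ((2 * π * u) ^ 2)) using 1
    field_simp
    ring
  rw [fejerIntegral, intervalIntegral.integral_eq_sub_of_hasDerivAt h
    (Continuous.intervalIntegrable (by fun_prop) _ _)]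
  simp only [mul_one, mul_zero, sin_zero, cos_zero, cos_two_pi_mul]
  field_simp
  ring

lemma fejerIntegral_zero : fejerIntegral 0 = 1 / 2 := by
  have : ∫ x in (0 : ℝ)..1, (1 - x) = 1 / 2 := by
    rw [intervalIntegral.integral_sub (by simp) (by simp)]
    norm_num
  simpa [fejerIntegral] using this

lemma integral_sin_two_pi_mul (u : ℝ) :
    ∫ x in (0 : ℝ)..1, sin (2 * π * u * x) = sin (π * u) ^ 2 / (π * u) := by
  rcases eq_or_ne u 0 with rfl | hu
  · simp
  have hp := pi_ne_zero
  have ha : 2 * π * u ≠ 0 := by positivity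
  have h : ∀ x ∈ uIcc (0 : ℝ) 1, HasDerivAt
      (fun x => - cos (2 * π * u * x) / (2 * π * u)) (sin (2 * π * u * x)) x := by
    intro x _
    have h1 : HasDerivAt (fun x => 2 * π * u * x) (2 * π * u) x := by
      simpa using (hasDerivAt_id x).const_mul (2 * π * u)
    convert! (h1.cos.neg).div_const (2 * π * u) using 1
    field_simp
  rw [intervalIntegral.integral_eq_sub_of_hasDerivAt h
    (Continuous.intervalIntegrable (by fun_prop) _ _)]
  simp only [mul_one, mul_zero, cos_zero, cos_two_pi_mul]
  field_simp
  ring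

/-- With θ = 2πux, sin(θ + 2πx) - sin θ = 2 sin(πx) cos(θ + πx). The sine cancels the denominator of
the cotangent, and 2 cos(πx) cos(θ + πx) = cos θ + cos(θ + 2πx). -/
lemma cotIntegral_add_one (u : ℝ) :
    cotIntegral (u + 1) = cotIntegral u + fejerIntegral u + fejerIntegral (u + 1) := by
  have e : cotIntegral (u + 1) - cotIntegral u = fejerIntegral u + fejerIntegral (u + 1) := by
    rw [cotIntegral, cotIntegral, fejerIntegral, fejerIntegral,
      ← intervalIntegral.integral_sub (intervalIntegrable_cotIntegral _)
        (intervalIntegrable_cotIntegral _),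
      ← intervalIntegral.integral_add (Continuous.intervalIntegrable (by fun_prop) _ _)
        (Continuous.intervalIntegrable (by fun_prop) _ _),
      intervalIntegral.integral_of_le zero_le_one, intervalIntegral.integral_of_le zero_le_one,
      integral_Ioc_eq_integral_Ioo, integral_Ioc_eq_integral_Ioo]
    refine setIntegral_congr_fun measurableSet_Ioo fun x hx => ?_
    have hs := (sin_pi_mul_pos hx.1 hx.2).ne'
    have e1 : 2 * π * (u + 1) * x = 2 * π * u * x + 2 * (π * x) := by ring
    simp only [e1, sin_add, cos_add, sin_two_mul, cos_two_mul]
    have h1 : cos (π * x) / sin (π * x) * sin (π * x) = cos (π * x) := by field_simp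
    have h2 := sin_sq_add_cos_sq (π * x)
    linear_combination (2 * (1 - x) * cos (2 * π * u * x) * cos (π * x)
      - 2 * (1 - x) * sin (2 * π * u * x) * sin (π * x)) * h1
      + 2 * (1 - x) * sin (2 * π * u * x) * (cos (π * x) / sin (π * x)) * h2
  linarith

/-- The recursion starts from 0 at u = 0. The Fejér term is 1/2 at 0 and vanishes at every positive
integer, so the value never changes after the first step. -/
lemma cotIntegral_natCast_add_one (n : ℕ) : cotIntegral (n + 1) = 1 / 2 := by
  have hz : ∀ m : ℕ, fejerIntegral (m + 1) = 0 := fun m => by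
    rw [fejerIntegral_eq (by positivity)]
    have : sin (π * ((m : ℝ) + 1)) = 0 := by
      have := sin_nat_mul_pi (m + 1)
      rw [mul_comm]; exact_mod_cast this
    simp [this]
  induction n with
  | zero =>
    have h := cotIntegral_add_one 0
    have h0 : cotIntegral 0 = 0 := by simp [cotIntegral]
    have h1 := hz 0
    simp only [Nat.cast_zero, zero_add] at h h1 ⊢
    rw [h, h0, h1, fejerIntegral_zero]; norm_num
  | succ n ih =>
    rw [cotIntegral_add_one, Nat.cast_succ, ih, hz n]
    have := hz (n + 1)
    push_cast at this
    rw [this]; norm_num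

lemma tendsto_integral_mul_exp_natCast {h : ℝ → ℝ} :
    Tendsto (fun n : ℕ => ∫ x in (0 : ℝ)..1, Complex.exp ((-(2 * π * n * x) : ℝ) * Complex.I) * h x)
      atTop (𝓝 0) := by
  have h1 := (Real.tendsto_integral_exp_smul_cocompact
    (fun x => indicator (Ioc (0 : ℝ) 1) (fun x => (h x : ℂ)) x)).comp
      (tendsto_natCast_atTop_atTop.mono_right atTop_le_cocompact)
  refine h1.congr fun n => ?_
  rw [intervalIntegral.integral_of_le zero_le_one, ← integral_indicator measurableSet_Ioc]
  refine integral_congr_ae (Eventually.of_forall fun x => ?_)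
  by_cases hx : x ∈ Ioc (0 : ℝ) 1
  · simp only [indicator_of_mem hx, Circle.smul_def, Real.fourierChar_apply,
      smul_eq_mul]
    congr 3
    push_cast; ring
  · simp [indicator_of_notMem hx]

lemma tendsto_integral_mul_sin_natCast {h : ℝ → ℝ} (hh : IntervalIntegrable h volume 0 1) :
    Tendsto (fun n : ℕ => ∫ x in (0 : ℝ)..1, sin (2 * π * n * x) * h x) atTop (𝓝 0) := by
  have h1 := (Complex.continuous_im.tendsto 0).comp (tendsto_integral_mul_exp_natCast (h := h))
  have h2 := h1.neg
  simp only [Complex.zero_im, neg_zero] at h2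
  refine h2.congr fun n => ?_
  have hi : IntervalIntegrable
      (fun x => Complex.exp ((-(2 * π * n * x) : ℝ) * Complex.I) * h x) volume 0 1 := by
    have hc : IntervalIntegrable (fun x => (h x : ℂ)) volume 0 1 :=
      ⟨hh.1.ofReal, hh.2.ofReal⟩
    exact hc.continuousOn_mul (Continuous.continuousOn (by fun_prop))
  simp only [Function.comp]
  rw [← Complex.imCLM_apply, ← Complex.imCLM.intervalIntegral_comp_comm hi,
    ← intervalIntegral.integral_neg]
  refine intervalIntegral.integral_congr fun x _ => ?_
  simp only [Complex.imCLM_apply, Complex.mul_im, Complex.exp_ofReal_mul_I_re,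
    Complex.exp_ofReal_mul_I_im, Complex.ofReal_re, Complex.ofReal_im, sin_neg]
  ring

lemma tendsto_integral_mul_cos_natCast {h : ℝ → ℝ} (hh : IntervalIntegrable h volume 0 1) :
    Tendsto (fun n : ℕ => ∫ x in (0 : ℝ)..1, cos (2 * π * n * x) * h x) atTop (𝓝 0) := by
  have h1 := (Complex.continuous_re.tendsto 0).comp (tendsto_integral_mul_exp_natCast (h := h))
  simp only [Complex.zero_re] at h1
  refine h1.congr fun n => ?_
  have hi : IntervalIntegrable
      (fun x => Complex.exp ((-(2 * π * n * x) : ℝ) * Complex.I) * h x) volume 0 1 := by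
    have hc : IntervalIntegrable (fun x => (h x : ℂ)) volume 0 1 :=
      ⟨hh.1.ofReal, hh.2.ofReal⟩
    exact hc.continuousOn_mul (Continuous.continuousOn (by fun_prop))
  simp only [Function.comp]
  rw [← Complex.reCLM_apply, ← Complex.reCLM.intervalIntegral_comp_comm hi]
  refine intervalIntegral.integral_congr fun x _ => ?_
  simp only [Complex.reCLM_apply, Complex.mul_re, Complex.exp_ofReal_mul_I_re,
    Complex.exp_ofReal_mul_I_im, Complex.ofReal_re, Complex.ofReal_im, cos_neg]
  ring

/-- Expanding sin(2πux + 2πnx) and writing cos(2πux) = 1 + (cos(2πux) - 1) isolates the integral at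
the integer n, equal to 1/2. The other two terms have integrable coefficients, the subtracted 1
removing the pole at 0, and vanish by Riemann–Lebesgue. -/
lemma tendsto_cotIntegral_add_natCast (u : ℝ) :
    Tendsto (fun n : ℕ => cotIntegral (u + n)) atTop (𝓝 (1 / 2)) := by
  have i1 := intervalIntegrable_cotIntegral u
  have i2 : IntervalIntegrable (fun x => (1 - x) * (cos (π * x) / sin (π * x)) *
      (cos (2 * π * u * x) - 1)) volume 0 1 := by
    refine intervalIntegrable_one_sub_mul_cot_mul (a := π * |u|) (by fun_prop) fun x h0 _ => ?_
    have h1 : |cos (2 * π * u * x) - 1| ≤ |2 * π * u * x| := by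
      simpa using abs_cos_sub_cos_le (2 * π * u * x) 0
    refine h1.trans (le_of_eq ?_)
    rw [abs_mul, abs_mul, abs_of_pos two_pi_pos, abs_of_pos h0]
    ring
  have h := ((tendsto_integral_mul_cos_natCast i1).add
    (tendsto_integral_mul_sin_natCast i2)).add_const (1 / 2)
  simp only [zero_add] at h
  refine h.congr' ?_
  filter_upwards [eventually_ge_atTop 1] with n hn
  obtain ⟨m, rfl⟩ : ∃ m, n = m + 1 := ⟨n - 1, by omega⟩
  have j1 : IntervalIntegrable (fun x => cos (2 * π * ((m + 1 : ℕ) : ℝ) * x) *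
      ((1 - x) * (cos (π * x) / sin (π * x)) * sin (2 * π * u * x))) volume 0 1 :=
    i1.continuousOn_mul (Continuous.continuousOn (by fun_prop))
  have j2 : IntervalIntegrable (fun x => sin (2 * π * ((m + 1 : ℕ) : ℝ) * x) *
      ((1 - x) * (cos (π * x) / sin (π * x)) * (cos (2 * π * u * x) - 1))) volume 0 1 :=
    i2.continuousOn_mul (Continuous.continuousOn (by fun_prop))
  have j3 := intervalIntegrable_cotIntegral ((m : ℝ) + 1)
  rw [← cotIntegral_natCast_add_one m, cotIntegral, cotIntegral,
    ← intervalIntegral.integral_add j1 j2, ← intervalIntegral.integral_add (j1.add j2) j3]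
  refine intervalIntegral.integral_congr fun x _ => ?_
  have e1 : 2 * π * (u + ((m + 1 : ℕ) : ℝ)) * x
      = 2 * π * u * x + 2 * π * ((m + 1 : ℕ) : ℝ) * x := by ring
  simp only [e1, sin_add]
  push_cast
  ring

/-- The weight in front of the sine in Beurling's majorant. -/
noncomputable def sineWeight (x : ℝ) : ℝ := (1 - x) * (cos (π * x) / sin (π * x)) + 1 / π

lemma measurable_sineWeight : Measurable sineWeight := by
  unfold sineWeight; fun_prop

/-- Beurling's entire majorant of the Heaviside function, through its Fourier representation. -/
noncomputable def beurling (v : ℝ) : ℝ :=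
  1 / 2 + ∫ x in (0 : ℝ)..1, ((1 - x) * cos (2 * π * v * x) + sineWeight x * sin (2 * π * v * x))

lemma beurling_eq (v : ℝ) : beurling v =
    1 / 2 + (fejerIntegral v + cotIntegral v + sin (π * v) ^ 2 / (π ^ 2 * v)) := by
  have i1 : IntervalIntegrable (fun x => (1 - x) * cos (2 * π * v * x)) volume 0 1 :=
    Continuous.intervalIntegrable (by fun_prop) _ _
  have i2 := intervalIntegrable_cotIntegral v
  have i3 : IntervalIntegrable (fun x => 1 / π * sin (2 * π * v * x)) volume 0 1 :=
    Continuous.intervalIntegrable (by fun_prop) _ _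
  have e3 : sin (π * v) ^ 2 / (π ^ 2 * v) = ∫ x in (0 : ℝ)..1, 1 / π * sin (2 * π * v * x) := by
    rw [intervalIntegral.integral_const_mul, integral_sin_two_pi_mul]
    field_simp
  rw [beurling, e3, fejerIntegral, cotIntegral, ← intervalIntegral.integral_add i1 i2,
    ← intervalIntegral.integral_add (i1.add i2) i3]
  congr 1
  refine intervalIntegral.integral_congr fun x _ => ?_
  simp only [sineWeight]
  ring

lemma fejerIntegral_neg (u : ℝ) : fejerIntegral (-u) = fejerIntegral u := by
  simp [fejerIntegral]

lemma cotIntegral_neg (u : ℝ) : cotIntegral (-u) = -cotIntegral u := by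
  simp [cotIntegral, ← intervalIntegral.integral_neg]

lemma beurling_add_beurling_neg (u : ℝ) : beurling u + beurling (-u) = 1 + 2 * fejerIntegral u := by
  rw [beurling_eq, beurling_eq, fejerIntegral_neg, cotIntegral_neg, mul_neg, sin_neg, mul_neg,
    div_neg]
  ring

lemma sin_sq_pi_mul_add_one (u : ℝ) : sin (π * (u + 1)) ^ 2 = sin (π * u) ^ 2 := by
  rw [mul_add, mul_one, sin_add_pi, neg_sq]

lemma tendsto_sin_sq_div_mul (u c : ℝ) (hc : 0 < c) :
    Tendsto (fun n : ℕ => sin (π * (u + n)) ^ 2 / (c * (u + n))) atTop (𝓝 0) := by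
  have ht : Tendsto (fun n : ℕ => c * (u + n)) atTop atTop :=
    (tendsto_atTop_add_const_left _ u tendsto_natCast_atTop_atTop).const_mul_atTop hc
  refine squeeze_zero_norm' ?_ (tendsto_const_nhds.div_atTop ht : Tendsto (fun n : ℕ =>
    (1 : ℝ) / (c * (u + n))) atTop (𝓝 0))
  filter_upwards [ht.eventually_gt_atTop 0] with n hn
  rw [norm_of_nonneg (by positivity)]
  gcongr
  exact sin_sq_le_one _

lemma tendsto_fejerIntegral (u : ℝ) :
    Tendsto (fun n : ℕ => fejerIntegral (u + n)) atTop (𝓝 0) := by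
  have ht : Tendsto (fun n : ℕ => u + (n : ℝ)) atTop atTop :=
    tendsto_atTop_add_const_left _ u tendsto_natCast_atTop_atTop
  have h := (tendsto_sin_sq_div_mul u (2 * π ^ 2) (by positivity)).mul
    (tendsto_const_nhds.div_atTop ht : Tendsto (fun n : ℕ => (1 : ℝ) / (u + n)) atTop (𝓝 0))
  simp only [mul_zero] at h
  refine h.congr' ?_
  filter_upwards [ht.eventually_gt_atTop 0] with n hn
  rw [fejerIntegral_eq hn.ne']
  field_simp

lemma tendsto_beurling_neg (u : ℝ) :
    Tendsto (fun n : ℕ => beurling (-(u + n))) atTop (𝓝 0) := by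
  have h := (((tendsto_fejerIntegral u).sub (tendsto_cotIntegral_add_natCast u)).sub
    (tendsto_sin_sq_div_mul u (π ^ 2) (by positivity))).const_add (1 / 2)
  simp only [zero_sub, sub_zero, add_neg_cancel] at h
  refine h.congr fun n => ?_
  rw [beurling_eq, fejerIntegral_neg, cotIntegral_neg, mul_neg, sin_neg, mul_neg, div_neg, neg_sq]
  ring

/-- Reduces each sign of the majorant to a unit-step difference, which is explicit because the
cotangent integral satisfies a first-order recursion and sin²(πu) has period 1. -/
lemma nonneg_of_antitone_step (f : ℝ → ℝ) {u : ℝ} (hu : 0 < u)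
    (hstep : ∀ v, 0 < v → f (v + 1) ≤ f v)
    (hlim : Tendsto (fun n : ℕ => f (u + n)) atTop (𝓝 0)) : 0 ≤ f u := by
  have : Antitone fun n : ℕ => f (u + n) := antitone_nat_of_succ_le fun n => by
    have := hstep (u + n) (by positivity)
    rw [add_assoc] at this
    exact_mod_cast this
  simpa using this.le_of_tendsto hlim 0

lemma beurling_neg_nonneg {u : ℝ} (hu : 0 < u) : 0 ≤ beurling (-u) := by
  refine nonneg_of_antitone_step (fun u => beurling (-u)) hu (fun v hv => ?_)
    (tendsto_beurling_neg u)
  have hv1 : 0 < v + 1 := by positivity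
  have key : beurling (-v) - beurling (-(v + 1))
      = sin (π * v) ^ 2 / (π ^ 2 * (v ^ 2 * (v + 1))) := by
    have e1 : ∀ u : ℝ, beurling (-u) =
        1 / 2 + (fejerIntegral u - cotIntegral u - sin (π * u) ^ 2 / (π ^ 2 * u)) := fun u => by
      rw [beurling_eq, fejerIntegral_neg, cotIntegral_neg, mul_neg, sin_neg, mul_neg, div_neg,
        neg_sq]
      ring
    rw [e1, e1, cotIntegral_add_one, sin_sq_pi_mul_add_one, fejerIntegral_eq hv.ne']
    field_simp
    ring
  have : 0 ≤ sin (π * v) ^ 2 / (π ^ 2 * (v ^ 2 * (v + 1))) := by positivity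
  linarith

/-- The odd parts cancel in `beurling_add_beurling_neg`, so the claim is that 2 `fejerIntegral u` -
`beurling (-u)` is nonnegative; this quantity also decreases to 0 along unit steps. -/
lemma one_le_beurling {u : ℝ} (hu : 0 < u) : 1 ≤ beurling u := by
  have h : 0 ≤ (fun u => 2 * fejerIntegral u - beurling (-u)) u := by
    refine nonneg_of_antitone_step (fun u => 2 * fejerIntegral u - beurling (-u)) hu
      (fun v hv => ?_) ?_
    · have hv1 : 0 < v + 1 := by positivity
      have key : (2 * fejerIntegral v - beurling (-v))
          - (2 * fejerIntegral (v + 1) - beurling (-(v + 1)))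
          = sin (π * v) ^ 2 / (π ^ 2 * (v * (v + 1) ^ 2)) := by
        have e1 : ∀ u : ℝ, beurling (-u) =
            1 / 2 + (fejerIntegral u - cotIntegral u - sin (π * u) ^ 2 / (π ^ 2 * u)) := fun u => by
          rw [beurling_eq, fejerIntegral_neg, cotIntegral_neg, mul_neg, sin_neg, mul_neg, div_neg,
            neg_sq]
          ring
        rw [e1, e1, cotIntegral_add_one, fejerIntegral_eq hv.ne', fejerIntegral_eq hv1.ne',
          sin_sq_pi_mul_add_one]
        field_simp
        ring
      have : 0 ≤ sin (π * v) ^ 2 / (π ^ 2 * (v * (v + 1) ^ 2)) := by positivity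
      linarith
    · have := ((tendsto_fejerIntegral u).const_mul 2).sub (tendsto_beurling_neg u)
      rwa [mul_zero, sub_zero] at this
  have := beurling_add_beurling_neg u
  simp only at h
  linarith

theorem indicator_Ici_le_beurling (v : ℝ) : (Ici (0 : ℝ)).indicator 1 v ≤ beurling v := by
  rcases lt_trichotomy v 0 with h | rfl | h
  · rw [indicator_of_notMem (by simpa using h)]
    simpa using beurling_neg_nonneg (neg_pos.2 h)
  · have := beurling_add_beurling_neg 0
    rw [fejerIntegral_zero, neg_zero] at this
    simp only [indicator_of_mem (self_mem_Ici), Pi.one_apply]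
    linarith
  · rw [indicator_of_mem (by simpa using h.le)]
    exact one_le_beurling h

/-! ### Elementary trigonometric inequalities -/

lemma cos_le_one_sub_sq_add_pow_four {x : ℝ} (h0 : 0 ≤ x) (h1 : x ≤ 4) :
    cos x ≤ 1 - x ^ 2 / 2 + x ^ 4 / 24 := by
  have h := sin_ge_sub_cube (x := x / 2) (by linarith)
  have h2 : cos x = 1 - 2 * sin (x / 2) ^ 2 := by
    rw [← mul_div_cancel₀ x (two_ne_zero), cos_two_mul, cos_sq']; ring_nf
  have h3 : 0 ≤ x / 2 - (x / 2) ^ 3 / 6 := by nlinarith [mul_nonneg h0 h0]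
  have h4 : (x / 2 - (x / 2) ^ 3 / 6) ^ 2 ≤ sin (x / 2) ^ 2 := by gcongr
  have h5 : 0 ≤ x ^ 6 := by positivity
  nlinarith

lemma cos_le_one_sub_sq_add_abs_pow_three (x : ℝ) :
    cos x ≤ 1 - x ^ 2 / 2 + |x| ^ 3 / 10 := by
  wlog h0 : 0 ≤ x generalizing x
  · simpa using this (-x) (by linarith)
  rw [abs_of_nonneg h0]
  rcases le_total x (12 / 5) with h | h
  · have h1 := cos_le_one_sub_sq_add_pow_four h0 (by linarith)
    -- The threshold 12/5 is where x⁴/24 = x³/10.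
    have h2 : x ^ 4 ≤ 12 / 5 * x ^ 3 := by
      have : 0 ≤ x ^ 3 := by positivity
      nlinarith
    linarith
  · have h1 : cos x = - cos (x - π) := by rw [cos_sub_pi, neg_neg]
    have h2 := one_sub_sq_div_two_le_cos (x := x - π)
    have hp1 := pi_gt_d4
    have hp2 := pi_lt_d4
    have h3 : (x - π) ^ 2 ≤ (x - 3.1415) ^ 2 + 0.0002 := by nlinarith
    -- Ten times the cubic in `h5` has its local minimum near 4.133; 1.734 is chosen so that this
    -- product matches its x² coefficient, leaving a positive constant to spare.
    have h4 := mul_nonneg (by linarith : 0 ≤ x - 1.734) (sq_nonneg (x - 4.133))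
    have h5 : 0 ≤ 2 - ((x - 3.1415) ^ 2 + 0.0002) / 2 - x ^ 2 / 2 + x ^ 3 / 10 := by nlinarith
    linarith

lemma norm_exp_I_mul_sub_one_sub_le {x : ℝ} (h0 : 0 ≤ x) :
    ‖Complex.exp (x * Complex.I) - 1 - x * Complex.I‖ ≤ x ^ 2 / 2 := by
  have hd (y : ℝ) : HasDerivAt (fun x : ℝ => Complex.exp (x * Complex.I) - 1 - x * Complex.I)
      ((Complex.exp (y * Complex.I) - 1) * Complex.I) y := by
    have h1 : HasDerivAt (fun y : ℝ => (y : ℂ) * Complex.I) Complex.I y := by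
      simpa using Complex.ofRealCLM.hasDerivAt.mul_const Complex.I
    convert! (h1.cexp.sub_const 1).sub h1 using 1
    ring
  refine image_norm_le_of_norm_deriv_right_le_deriv_boundary (a := 0) (b := x)
    (B := fun x => x ^ 2 / 2) (B' := fun x => x)
    (fun y _ => (hd y).continuousAt.continuousWithinAt) (fun y _ => (hd y).hasDerivWithinAt)
    (by simp) (fun y => ?_) (fun y hy => ?_) (right_mem_Icc.2 h0)
  · convert! (hasDerivAt_pow 2 y).div_const 2 using 1
    ring
  · rw [norm_mul, Complex.norm_I, mul_one, mul_comm]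
    simpa [abs_of_nonneg hy.1] using norm_exp_I_mul_ofReal_sub_one_le (x := y)

/-- The derivative of this remainder is, up to the factor i, the remainder of the previous order, so
the bound is integrated once more; conjugation reduces to x ≥ 0. -/
lemma norm_exp_I_mul_sub_taylor_two_le (x : ℝ) :
    ‖Complex.exp (x * Complex.I) - 1 - x * Complex.I + x ^ 2 / 2‖ ≤ |x| ^ 3 / 6 := by
  wlog h0 : 0 ≤ x generalizing x
  · have h := this (-x) (by linarith)
    rw [abs_neg, ← Complex.norm_conj] at h
    refine le_trans (le_of_eq (congrArg _ ?_)) h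
    simp [← Complex.exp_conj, map_ofNat]
    ring
  rw [abs_of_nonneg h0]
  have hd (y : ℝ) : HasDerivAt
      (fun x : ℝ => Complex.exp (x * Complex.I) - 1 - x * Complex.I + (x : ℂ) ^ 2 / 2)
      ((Complex.exp (y * Complex.I) - 1 - y * Complex.I) * Complex.I) y := by
    have h0 : HasDerivAt (fun y : ℝ => (y : ℂ)) 1 y := Complex.ofRealCLM.hasDerivAt
    have h1 : HasDerivAt (fun y : ℝ => (y : ℂ) * Complex.I) Complex.I y := by
      simpa using h0.mul_const Complex.I
    convert! ((h1.cexp.sub_const 1).sub h1).add ((h0.pow 2).div_const 2) using 1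
    have := Complex.I_mul_I
    push_cast
    linear_combination (-(y : ℂ)) * this
  refine image_norm_le_of_norm_deriv_right_le_deriv_boundary (a := 0) (b := x)
    (B := fun x => x ^ 3 / 6) (B' := fun x => x ^ 2 / 2)
    (fun y _ => (hd y).continuousAt.continuousWithinAt) (fun y _ => (hd y).hasDerivWithinAt)
    (by simp) (fun y => ?_) (fun y hy => ?_) (right_mem_Icc.2 h0)
  · convert! (hasDerivAt_pow 3 y).div_const 6 using 1
    push_cast
    ring
  · rw [norm_mul, Complex.norm_I, mul_one]
    exact norm_exp_I_mul_sub_one_sub_le hy.1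

/-- (1 - y²/3)(y - y³/6) = y - y³/2 + y⁵/18, which dominates y(1 - y²/2 + y⁴/24). -/
lemma cos_div_sin_le {y : ℝ} (h0 : 0 < y) (h1 : y ≤ π / 2) :
    cos y / sin y ≤ 1 / y - y / 3 := by
  have hp := pi_lt_d2
  have hs : 0 < sin y := sin_pos_of_pos_of_lt_pi h0 (by linarith)
  have hc := cos_le_one_sub_sq_add_pow_four h0.le (by linarith)
  have hs' := sin_ge_sub_cube h0.le
  have h3 : 0 ≤ 1 - y ^ 2 / 3 := by nlinarith
  have h4 := mul_le_mul_of_nonneg_left hs' h3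
  have h5 := mul_le_mul_of_nonneg_left hc h0.le
  have e : 1 / y - y / 3 = (1 - y ^ 2 / 3) / y := by field_simp
  rw [e, div_le_div_iff₀ hs h0]
  have : 0 ≤ y ^ 5 := by positivity
  nlinarith

lemma sub_le_cos_div_sin {y : ℝ} (h0 : 0 < y) (h1 : y ≤ π / 2) :
    1 / y - y / 2 ≤ cos y / sin y := by
  have hs : 0 < sin y := sin_pos_of_pos_of_lt_pi h0 (by linarith [pi_pos])
  have hc : 0 ≤ cos y := cos_nonneg_of_neg_pi_div_two_le_of_le (by linarith) h1
  calc 1 / y - y / 2 = (1 - y ^ 2 / 2) / y := by field_simp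
    _ ≤ cos y / y := by gcongr; exact one_sub_sq_div_two_le_cos
    _ ≤ cos y / sin y := by gcongr; exact sin_le h0.le

/-! ### Bounds on the weights of Beurling's majorant -/

lemma pi_sq_le : π ^ 2 ≤ 9.87 := by nlinarith [pi_lt_d4, pi_pos]

lemma sq_add_sineWeight_sq_le_of_le_half {x : ℝ} (h0 : 0 < x) (h1 : x ≤ 1 / 2) :
    (1 - x) ^ 2 + sineWeight x ^ 2 ≤ (0.335 / x) ^ 2 := by
  have hp := pi_pos
  have hy : π * x ≤ π / 2 := by nlinarith
  have hC := cos_div_sin_le (mul_pos hp h0) hy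
  have hC0 : 0 ≤ cos (π * x) / sin (π * x) :=
    div_nonneg (cos_nonneg_of_neg_pi_div_two_le_of_le (by nlinarith) hy)
      (sin_nonneg_of_nonneg_of_le_pi (by positivity) (by linarith))
  have hx : 0 ≤ 1 - x := by linarith
  have hk0 : 0 ≤ x * sineWeight x := by unfold sineWeight; positivity
  have hk : x * sineWeight x ≤ 1 / π - (1 - x) * π * x ^ 2 / 3 := by
    have := mul_le_mul_of_nonneg_left hC hx
    have h3 : x * sineWeight x ≤ x * ((1 - x) * (1 / (π * x) - π * x / 3) + 1 / π) := by
      unfold sineWeight; gcongr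
    refine h3.trans (le_of_eq ?_)
    field_simp
    ring
  have hk2 : (x * sineWeight x) ^ 2 ≤ (1 / π - (1 - x) * π * x ^ 2 / 3) ^ 2 := by gcongr
  have e : (1 / π - (1 - x) * π * x ^ 2 / 3) ^ 2
      = (1 / π) ^ 2 - 2 / 3 * (1 - x) * x ^ 2 + (1 - x) ^ 2 * x ^ 4 / 9 * π ^ 2 := by
    field_simp
    ring
  have hq : (1 / π) ^ 2 ≤ 0.10134 := by
    rw [div_pow, one_pow, div_le_iff₀ (by positivity)]
    nlinarith [pi_gt_d4]
  have hq2 : (1 - x) ^ 2 * x ^ 4 / 9 * π ^ 2 ≤ (1 - x) ^ 2 * x ^ 4 / 9 * 9.87 := by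
    gcongr
    exact pi_sq_le
  -- With u = x²(1 - x) the left side is about 0.10134 + u(1/3 - x + 1.0967u), and 0.335² - 0.10134
  -- exceeds 0.0108.
  have hpoly : x ^ 2 * (1 - x) ^ 2 + (0.10134 - 2 / 3 * (1 - x) * x ^ 2
      + (1 - x) ^ 2 * x ^ 4 / 9 * 9.87) ≤ 0.335 ^ 2 := by
    have h5 : x ^ 2 * (1 - x) ≤ 4 / 27 := by nlinarith [sq_nonneg (x - 2 / 3)]
    have h6 : 0 ≤ x ^ 2 * (1 - x) := by positivity
    have h7 : x ^ 2 * (1 - x) * (1 / 3 - x + 1.0967 * (x ^ 2 * (1 - x))) ≤ 0.0108 := by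
      -- On [a, b] within [0, 1/2] the function u is increasing, so u is taken at b and -x at -a.
      -- Six such subintervals suffice for the bound 0.0108.
      have key : ∀ a b : ℝ, 0 ≤ a → a ≤ x → x ≤ b → b ≤ 1 / 2 →
          0 ≤ 1 / 3 - a + 1.0967 * (b ^ 2 * (1 - b)) →
          b ^ 2 * (1 - b) * (1 / 3 - a + 1.0967 * (b ^ 2 * (1 - b))) ≤ 0.0108 →
          x ^ 2 * (1 - x) * (1 / 3 - x + 1.0967 * (x ^ 2 * (1 - x))) ≤ 0.0108 := by
        intro a b ha hax hxb hb hpos hab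
        have hm : x ^ 2 * (1 - x) ≤ b ^ 2 * (1 - b) := by
          have g1 : 0 ≤ b + x - (b ^ 2 + b * x + x ^ 2) := by nlinarith
          linarith [mul_nonneg (sub_nonneg.2 hxb) g1]
        refine le_trans ?_ hab
        exact (mul_le_mul_of_nonneg_left (by linarith) h6).trans
          (mul_le_mul_of_nonneg_right hm hpos)
      rcases le_total x 0.18 with g1 | g1
      · exact key 0 0.18 le_rfl h0.le g1 (by norm_num) (by norm_num) (by norm_num)
      rcases le_total x 0.25 with g2 | g2
      · exact key 0.18 0.25 (by norm_num) g1 g2 (by norm_num) (by norm_num) (by norm_num)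
      rcases le_total x 0.3 with g3 | g3
      · exact key 0.25 0.3 (by norm_num) g2 g3 (by norm_num) (by norm_num) (by norm_num)
      rcases le_total x 0.36 with g4 | g4
      · exact key 0.3 0.36 (by norm_num) g3 g4 (by norm_num) (by norm_num) (by norm_num)
      rcases le_total x 0.42 with g5 | g5
      · exact key 0.36 0.42 (by norm_num) g4 g5 (by norm_num) (by norm_num) (by norm_num)
      · exact key 0.42 0.5 (by norm_num) g5 (by linarith) (by norm_num) (by norm_num) (by norm_num)
    nlinarith
  rw [div_pow, le_div_iff₀ (by positivity)]
  nlinarith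

/-- Reflecting x = 1 - w turns the weight into w(1/(πw) - cot(πw)), which vanishes with w. The
constant works since 1 + 9.87/16 < 1.28². -/
lemma sq_add_sineWeight_sq_le_of_half_le {x : ℝ} (h0 : 1 / 2 ≤ x) (h1 : x < 1) :
    (1 - x) ^ 2 + sineWeight x ^ 2 ≤ (1.28 * (1 - x)) ^ 2 := by
  obtain ⟨w, rfl⟩ : ∃ w, x = 1 - w := ⟨1 - x, by ring⟩
  have hp := pi_pos
  have hw : 0 < w := by linarith
  have hy : π * w ≤ π / 2 := by nlinarith
  have hC := sub_le_cos_div_sin (mul_pos hp hw) hy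
  have hC2 := cos_div_sin_le (mul_pos hp hw) hy
  have e : sineWeight (1 - w) = w * (1 / (π * w) - cos (π * w) / sin (π * w)) := by
    rw [sineWeight, mul_sub π, mul_one, cos_pi_sub, sin_pi_sub]
    field_simp
    ring
  have h2 : 0 ≤ 1 / (π * w) - cos (π * w) / sin (π * w) := by
    have : 0 ≤ π * w / 3 := by positivity
    linarith
  have h3 : (1 / (π * w) - cos (π * w) / sin (π * w)) ^ 2 ≤ (π * w / 2) ^ 2 := by
    gcongr; linarith
  have h4 : (π * w / 2) ^ 2 ≤ 9.87 / 16 := by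
    have : w ^ 2 ≤ 1 / 4 := by nlinarith
    calc (π * w / 2) ^ 2 = π ^ 2 * w ^ 2 / 4 := by ring
      _ ≤ 9.87 * (1 / 4) / 4 := by gcongr; exact pi_sq_le
      _ = _ := by norm_num
  rw [e, mul_pow, sub_sub_cancel, mul_pow]
  nlinarith [sq_nonneg w]

/-- After subtracting the inversion kernel 1/(πx), the pole at 0 is gone. This is the weight met by
the Gaussian part of the characteristic function, whose cost is therefore at most its modulus. -/
lemma sq_add_sineWeight_sub_sq_le_one {x : ℝ} (h0 : 0 < x) (h1 : x ≤ 1 / 2) :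
    (1 - x) ^ 2 + (sineWeight x - 1 / (π * x)) ^ 2 ≤ 1 := by
  have hp := pi_pos
  have hy : π * x ≤ π / 2 := by nlinarith
  have hC := sub_le_cos_div_sin (mul_pos hp h0) hy
  have hC2 := cos_div_sin_le (mul_pos hp h0) hy
  have e : sineWeight x - 1 / (π * x)
      = - ((1 - x) * (1 / (π * x) - cos (π * x) / sin (π * x))) := by
    rw [sineWeight]
    field_simp
    ring
  have h2 : 0 ≤ 1 / (π * x) - cos (π * x) / sin (π * x) := by
    have : 0 ≤ π * x / 3 := by positivity
    linarith
  have h3 : (1 / (π * x) - cos (π * x) / sin (π * x)) ^ 2 ≤ (π * x / 2) ^ 2 := by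
    gcongr; linarith
  have h4 : (π * x / 2) ^ 2 ≤ 2.5 * x ^ 2 := by
    nlinarith [pi_sq_le, sq_nonneg x]
  rw [e, neg_sq, mul_pow]
  have h5 : (1 - x) ^ 2 * (1 + 2.5 * x ^ 2) ≤ 1 := by
    nlinarith [mul_nonneg h0.le (by linarith : 0 ≤ 1 / 2 - x), mul_pos h0 h0,
      mul_nonneg (mul_pos h0 h0).le (by linarith : 0 ≤ 1 / 2 - x)]
  nlinarith [sq_nonneg (1 - x)]

/-! ### Characteristic functions of standardized laws with a third moment -/

section Moments

variable {ν : Measure ℝ} [IsProbabilityMeasure ν]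

lemma integrable_sq_of_pow_three (h3 : Integrable (fun x => |x| ^ 3) ν) :
    Integrable (fun x => x ^ 2) ν := by
  refine ((integrable_const (1 : ℝ)).add h3).mono' (by fun_prop) (Eventually.of_forall fun x => ?_)
  rw [norm_of_nonneg (sq_nonneg x), ← sq_abs, Pi.add_apply]
  have := abs_nonneg x
  rcases le_total |x| 1 with h | h
  · nlinarith [pow_nonneg this 3]
  · nlinarith [mul_nonneg (sq_nonneg |x|) (sub_nonneg.2 h)]

lemma integrable_id_of_sq (h2 : Integrable (fun x => x ^ 2) ν) :
    Integrable (fun x => x) ν := by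
  refine ((integrable_const (1 : ℝ)).add h2).mono' (by fun_prop) (Eventually.of_forall fun x => ?_)
  rw [norm_eq_abs, Pi.add_apply]
  nlinarith [sq_nonneg (|x| - 1), sq_abs x]

/-- The functions needed to integrate (x - y)²(|x| + |y|) against two independent copies: it is used
first in y for fixed x, then in x. -/
lemma integral_moments (hm : ∫ x, x ∂ν = 0) (hv : ∫ x, x ^ 2 ∂ν = 1)
    (h3 : Integrable (fun x => |x| ^ 3) ν) (a b c d e f : ℝ) :
    Integrable (fun x => a + b * x + c * x ^ 2 + d * |x| + e * (x * |x|) + f * |x| ^ 3) ν ∧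
    ∫ x, (a + b * x + c * x ^ 2 + d * |x| + e * (x * |x|) + f * |x| ^ 3) ∂ν
      = a + c + d * (∫ x, |x| ∂ν) + e * (∫ x, x * |x| ∂ν) + f * ∫ x, |x| ^ 3 ∂ν := by
  have i2 := integrable_sq_of_pow_three h3
  have i1 := integrable_id_of_sq i2
  have ia : Integrable (fun x => |x|) ν := i1.abs
  have ix : Integrable (fun x => x * |x|) ν := i2.mono (by fun_prop)
    (Eventually.of_forall fun x => by simp [← sq])
  have j1 := (integrable_const a).add (i1.const_mul b) (μ := ν)
  have j2 := j1.add (i2.const_mul c)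
  have j3 := j2.add (ia.const_mul d)
  have j4 := j3.add (ix.const_mul e)
  have j5 := j4.add (h3.const_mul f)
  refine ⟨j5, ?_⟩
  calc _ = _ := integral_add j4 (h3.const_mul f)
    _ = _ := by
      rw [integral_const_mul]
      congr 1
      refine (integral_add j3 (ix.const_mul e)).trans ?_
      rw [integral_const_mul]
      congr 1
      refine (integral_add j2 (ia.const_mul d)).trans ?_
      rw [integral_const_mul]
      congr 1
      refine (integral_add j1 (i2.const_mul c)).trans ?_
      rw [integral_const_mul, hv, mul_one]
      congr 1
      refine (integral_add (integrable_const a) (i1.const_mul b)).trans ?_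
      rw [integral_const_mul, hm]
      simp

lemma one_le_integral_abs_pow_three (hv : ∫ x, x ^ 2 ∂ν = 1)
    (h3 : Integrable (fun x => |x| ^ 3) ν) : 1 ≤ ∫ x, |x| ^ 3 ∂ν := by
  have h : ∫ x, x ^ 2 ∂ν ≤ ∫ x, (1 / 3 + 2 / 3 * |x| ^ 3) ∂ν := by
    refine integral_mono (integrable_sq_of_pow_three h3)
      ((integrable_const _).add (h3.const_mul _)) fun x => ?_
    have := abs_nonneg x
    simp only
    rw [← sq_abs]
    nlinarith [mul_nonneg (by linarith : 0 ≤ 1 + 2 * |x|) (sq_nonneg (|x| - 1))]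
  rw [hv, integral_add (integrable_const _) (h3.const_mul _), integral_const_mul] at h
  simp at h
  linarith

lemma integral_abs_le_one (hv : ∫ x, x ^ 2 ∂ν = 1) (h2 : Integrable (fun x => x ^ 2) ν) :
    ∫ x, |x| ∂ν ≤ 1 := by
  have h : ∫ x, |x| ∂ν ≤ ∫ x, (1 / 2 + 1 / 2 * x ^ 2) ∂ν := by
    refine integral_mono (integrable_id_of_sq h2).abs
      ((integrable_const _).add (h2.const_mul _)) fun x => ?_
    simp only
    nlinarith [sq_nonneg (|x| - 1), sq_abs x]
  rw [integral_add (integrable_const _) (h2.const_mul _), integral_const_mul, hv] at h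
  norm_num at h
  linarith

lemma norm_charFun_sub_taylor_two_le (hm : ∫ x, x ∂ν = 0) (hv : ∫ x, x ^ 2 ∂ν = 1)
    (h3 : Integrable (fun x => |x| ^ 3) ν) (s : ℝ) :
    ‖charFun ν s - (1 - s ^ 2 / 2)‖ ≤ (∫ x, |x| ^ 3 ∂ν) * |s| ^ 3 / 6 := by
  have i2 := integrable_sq_of_pow_three h3
  have i1 := integrable_id_of_sq i2
  have ie : Integrable (fun x : ℝ => Complex.exp (s * x * Complex.I)) ν := by
    refine (integrable_const (1 : ℝ)).mono' (by fun_prop) (Eventually.of_forall fun x => ?_)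
    rw [← Complex.ofReal_mul, Complex.norm_exp_ofReal_mul_I]
  have j1 : Integrable (fun x : ℝ => (s * x * Complex.I : ℂ)) ν :=
    (i1.ofReal.const_mul (s : ℂ)).mul_const _
  have j2 : Integrable (fun x : ℝ => ((s * x : ℂ)) ^ 2 / 2) ν := by
    have : Integrable (fun x : ℝ => (s ^ 2 / 2 : ℂ) * ((x ^ 2 : ℝ) : ℂ)) ν :=
      i2.ofReal.const_mul _
    refine this.congr (Eventually.of_forall fun x => ?_)
    push_cast; ring
  have e : charFun ν s - (1 - s ^ 2 / 2) =
      ∫ x : ℝ, (Complex.exp (s * x * Complex.I) - 1 - s * x * Complex.I + (s * x : ℂ) ^ 2 / 2) ∂ν := by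
    have k1 : Integrable (fun x : ℝ => Complex.exp (s * x * Complex.I) - 1) ν :=
      ie.sub (integrable_const 1)
    have k2 : Integrable (fun x : ℝ => Complex.exp (s * x * Complex.I) - 1 - s * x * Complex.I) ν :=
      k1.sub j1
    rw [integral_add k2 j2, integral_sub k1 j1, integral_sub ie (integrable_const 1),
      charFun_apply_real]
    have e1 : ∫ x : ℝ, (s * x * Complex.I : ℂ) ∂ν = 0 := by
      rw [integral_mul_const, integral_const_mul, integral_complex_ofReal, hm]
      simp
    have e2 : ∫ x : ℝ, ((s * x : ℂ)) ^ 2 / 2 ∂ν = (s : ℂ) ^ 2 / 2 := by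
      have : ∀ x : ℝ, (s * x : ℂ) ^ 2 / 2 = (s ^ 2 / 2 : ℂ) * ((x ^ 2 : ℝ) : ℂ) := fun x => by
        push_cast; ring
      simp_rw [this]
      rw [integral_const_mul, integral_complex_ofReal, hv]
      simp
    rw [e1, e2]
    simp
    ring
  rw [e]
  calc _ ≤ ∫ x : ℝ, |x| ^ 3 * (|s| ^ 3 / 6) ∂ν := by
        refine norm_integral_le_of_norm_le (h3.mul_const _) (Eventually.of_forall fun x => ?_)
        have := norm_exp_I_mul_sub_taylor_two_le (s * x)
        rw [abs_mul] at this
        push_cast at this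
        refine this.trans (le_of_eq ?_)
        ring
    _ = _ := by rw [integral_mul_const]; ring

/-- |φ(s)|² is the expectation of cos(s(X - Y)) for independent copies X, Y. By the cubic cosine
bound it remains to estimate E|X - Y|³ ≤ E (X - Y)²(|X| + |Y|) = 2β + 2E|X| ≤ 4β, the cross terms
vanishing since the means are zero; a tenth of this is 0.4β. -/
lemma sq_norm_charFun_le (hm : ∫ x, x ∂ν = 0) (hv : ∫ x, x ^ 2 ∂ν = 1)
    (h3 : Integrable (fun x => |x| ^ 3) ν) (s : ℝ) :
    ‖charFun ν s‖ ^ 2 ≤ 1 - s ^ 2 + 0.4 * (∫ x, |x| ^ 3 ∂ν) * |s| ^ 3 := by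
  have i2 := integrable_sq_of_pow_three h3
  set β := ∫ x, |x| ^ 3 ∂ν with hβ
  set m := ∫ x, |x| ∂ν with hm'
  set q := ∫ x, x * |x| ∂ν with hq
  have hβ1 : 1 ≤ β := one_le_integral_abs_pow_three hv h3
  have hm1 : m ≤ 1 := integral_abs_le_one hv i2
  set C := ∫ x, cos (s * x) ∂ν with hC
  set S := ∫ x, sin (s * x) ∂ν with hS
  have ic : Integrable (fun x => cos (s * x)) ν :=
    (integrable_const (1 : ℝ)).mono' (by fun_prop)
      (Eventually.of_forall fun x => abs_cos_le_one _)
  have is : Integrable (fun x => sin (s * x)) ν :=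
    (integrable_const (1 : ℝ)).mono' (by fun_prop)
      (Eventually.of_forall fun x => abs_sin_le_one _)
  have ie : Integrable (fun x : ℝ => Complex.exp (s * x * Complex.I)) ν := by
    refine (integrable_const (1 : ℝ)).mono' (by fun_prop) (Eventually.of_forall fun x => ?_)
    rw [← Complex.ofReal_mul, Complex.norm_exp_ofReal_mul_I]
  have eRe : (charFun ν s).re = C := by
    rw [charFun_apply_real, ← Complex.reCLM_apply, ← Complex.reCLM.integral_comp_comm ie]
    refine integral_congr_ae (Eventually.of_forall fun x => ?_)
    simp only [Complex.reCLM_apply, ← Complex.ofReal_mul, Complex.exp_ofReal_mul_I_re]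
  have eIm : (charFun ν s).im = S := by
    rw [charFun_apply_real, ← Complex.imCLM_apply, ← Complex.imCLM.integral_comp_comm ie]
    refine integral_congr_ae (Eventually.of_forall fun x => ?_)
    simp only [Complex.imCLM_apply, ← Complex.ofReal_mul, Complex.exp_ofReal_mul_I_im]
  have e1 : ‖charFun ν s‖ ^ 2 = ∫ x, (C * cos (s * x) + S * sin (s * x)) ∂ν := by
    rw [← Complex.normSq_eq_norm_sq, Complex.normSq_apply, eRe, eIm,
      integral_add (ic.const_mul C) (is.const_mul S), integral_const_mul, integral_const_mul]
  have e2 (x : ℝ) : C * cos (s * x) + S * sin (s * x) ≤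
      (1 - s ^ 2 / 2 + |s| ^ 3 / 10 * β) + (- (|s| ^ 3 / 5 * q)) * x
        + (- (s ^ 2 / 2) + |s| ^ 3 / 10 * m) * x ^ 2 + |s| ^ 3 / 10 * |x|
        + 0 * (x * |x|) + |s| ^ 3 / 10 * |x| ^ 3 := by
    have h1 : C * cos (s * x) + S * sin (s * x) = ∫ y, cos (s * (x - y)) ∂ν := by
      rw [mul_comm C, mul_comm S, hC, hS, ← integral_const_mul, ← integral_const_mul,
        ← integral_add (ic.const_mul _) (is.const_mul _)]
      refine integral_congr_ae (Eventually.of_forall fun y => ?_)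
      simp only
      rw [mul_sub, cos_sub]
    obtain ⟨i, hi⟩ := integral_moments hm hv h3
      (1 - s ^ 2 / 2 * x ^ 2 + |s| ^ 3 / 10 * |x| ^ 3)
      (s ^ 2 * x - |s| ^ 3 / 5 * (x * |x|)) (- (s ^ 2 / 2) + |s| ^ 3 / 10 * |x|)
      (|s| ^ 3 / 10 * x ^ 2) (- (|s| ^ 3 / 5 * x)) (|s| ^ 3 / 10)
    rw [h1]
    have icy : Integrable (fun y => cos (s * (x - y))) ν :=
      (integrable_const (1 : ℝ)).mono' (by fun_prop)
        (Eventually.of_forall fun x => abs_cos_le_one _)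
    refine (integral_mono icy i fun y => ?_).trans (le_of_eq (hi.trans (by ring)))
    have g1 := cos_le_one_sub_sq_add_abs_pow_three (s * (x - y))
    have g2 : |x - y| ^ 3 ≤ (x - y) ^ 2 * (|x| + |y|) := by
      rw [pow_succ, sq_abs]
      gcongr
      exact abs_sub x y
    have g3 : |s| ^ 3 * |x - y| ^ 3 ≤ |s| ^ 3 * ((x - y) ^ 2 * (|x| + |y|)) := by gcongr
    have g4 (z : ℝ) : |z| ^ 3 = z ^ 2 * |z| := by rw [pow_succ, sq_abs]
    rw [abs_mul, mul_pow, mul_pow] at g1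
    simp only [g4 x, g4 y]
    nlinarith
  rw [e1]
  obtain ⟨i, hi⟩ := integral_moments hm hv h3
    (1 - s ^ 2 / 2 + |s| ^ 3 / 10 * β) (- (|s| ^ 3 / 5 * q))
    (- (s ^ 2 / 2) + |s| ^ 3 / 10 * m) (|s| ^ 3 / 10) 0 (|s| ^ 3 / 10)
  refine (integral_mono ((ic.const_mul C).add (is.const_mul S)) i e2).trans ?_
  rw [hi]
  have : 0 ≤ |s| ^ 3 := by positivity
  nlinarith

end Moments

/-- Telescoping: each of the n + 1 terms carries one difference and n factors of modulus at most r.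
-/
lemma norm_pow_sub_pow_le {a b : ℂ} {r : ℝ} (ha : ‖a‖ ≤ r) (hb : ‖b‖ ≤ r) (n : ℕ) :
    ‖a ^ (n + 1) - b ^ (n + 1)‖ ≤ (n + 1) * ‖a - b‖ * r ^ n := by
  have hr : 0 ≤ r := (norm_nonneg a).trans ha
  induction n with
  | zero => simp
  | succ n ih =>
    have e : a ^ (n + 1 + 1) - b ^ (n + 1 + 1)
        = a ^ (n + 1) * (a - b) + (a ^ (n + 1) - b ^ (n + 1)) * b := by ring
    rw [e]
    calc _ ≤ ‖a‖ ^ (n + 1) * ‖a - b‖ + ‖a ^ (n + 1) - b ^ (n + 1)‖ * ‖b‖ := by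
          refine (norm_add_le _ _).trans (le_of_eq ?_)
          rw [norm_mul, norm_mul, norm_pow]
      _ ≤ r ^ (n + 1) * ‖a - b‖ + ((n + 1) * ‖a - b‖ * r ^ n) * r := by gcongr
      _ = _ := by push_cast; ring

lemma abs_exp_neg_sub_one_sub_le {y : ℝ} (hy : 0 ≤ y) : |exp (-y) - (1 - y)| ≤ y ^ 2 / 2 := by
  have h1 := one_sub_le_exp_neg y
  have h2 := quadratic_le_exp_of_nonneg hy
  rw [abs_of_nonneg (by linarith), exp_neg]
  have h3 : (exp y)⁻¹ ≤ (1 + y + y ^ 2 / 2)⁻¹ := by gcongr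
  have h4 : (1 + y + y ^ 2 / 2)⁻¹ ≤ 1 - y + y ^ 2 / 2 := by
    rw [inv_le_iff_one_le_mul₀ (by positivity)]
    nlinarith [pow_nonneg hy 4]
  linarith

section Power

variable {ν : Measure ℝ} [IsProbabilityMeasure ν]

lemma norm_charFun_le_exp (hm : ∫ x, x ∂ν = 0) (hv : ∫ x, x ^ 2 ∂ν = 1)
    (h3 : Integrable (fun x => |x| ^ 3) ν) (s : ℝ) :
    ‖charFun ν s‖ ≤ exp (- (s ^ 2 / 2 * (1 - 0.4 * (∫ x, |x| ^ 3 ∂ν) * |s|))) := by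
  refine le_of_sq_le_sq ?_ (exp_pos _).le
  rw [← exp_nat_mul]
  refine (sq_norm_charFun_le hm hv h3 s).trans ((add_one_le_exp _).trans' (le_of_eq ?_))
  have : |s| ^ 3 = s ^ 2 * |s| := by rw [pow_succ, sq_abs]
  rw [this]
  push_cast
  ring

variable {n : ℕ} {ε t : ℝ}

lemma norm_charFun_pow_le (hm : ∫ x, x ∂ν = 0) (hv : ∫ x, x ^ 2 ∂ν = 1)
    (h3 : Integrable (fun x => |x| ^ 3) ν) (hn : 1 ≤ n)
    (hε : (∫ x, |x| ^ 3 ∂ν) = ε * √n) (ht : 0 ≤ t) :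
    ‖charFun ν (t / √n) ^ n‖ ≤ exp (- (t ^ 2 / 2 * (1 - 0.4 * ε * t))) := by
  have hs : 0 < √(n : ℝ) := by positivity
  have hs2 : √(n : ℝ) ^ 2 = n := sq_sqrt (by positivity)
  rw [norm_pow]
  refine (pow_le_pow_left₀ (norm_nonneg _) (norm_charFun_le_exp hm hv h3 _) n).trans (le_of_eq ?_)
  rw [← exp_nat_mul, hε, abs_of_nonneg (by positivity), div_pow, hs2]
  congr 1
  field_simp

lemma norm_charFun_pow_sub_le (hm : ∫ x, x ∂ν = 0) (hv : ∫ x, x ^ 2 ∂ν = 1)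
    (h3 : Integrable (fun x => |x| ^ 3) ν) (hn : 1 ≤ n)
    (hε : (∫ x, |x| ^ 3 ∂ν) = ε * √n) (ht : 0 ≤ t) (hεt : 0.4 * ε * t ≤ 1) :
    ‖charFun ν (t / √n) ^ n - Complex.exp (-(t ^ 2 / 2))‖ ≤
      (ε * t ^ 3 / 6 + ε ^ 2 * t ^ 4 / 8) *
        exp (- ((1 - ε ^ 2) * (t ^ 2 / 2 * (1 - 0.4 * ε * t)))) := by
  obtain ⟨k, rfl⟩ : ∃ k, n = k + 1 := ⟨n - 1, by omega⟩
  set N : ℝ := ((k + 1 : ℕ) : ℝ) with hN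
  have hN0 : 0 < N := by positivity
  have hs : 0 < √N := by positivity
  have hs2 : √N ^ 2 = N := sq_sqrt (by positivity)
  have hβ1 := one_le_integral_abs_pow_three hv h3
  have hε0 : 0 < ε := by
    by_contra h
    nlinarith
  -- Nε² = β², and β ≥ 1 for a standardized law.
  have hNε : 1 / N ≤ ε ^ 2 := by
    rw [div_le_iff₀ hN0, ← hs2, ← mul_pow, ← hε]
    nlinarith
  set s := t / √N with hsdef
  have hs0 : 0 ≤ s := by positivity
  have hst : s ^ 2 * N = t ^ 2 := by rw [hsdef, div_pow, hs2]; field_simp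
  have hεs : ε * √N * s = ε * t := by rw [hsdef]; field_simp
  set r := exp (- (s ^ 2 / 2 * (1 - 0.4 * ε * t))) with hr
  have h1 : ‖charFun ν s‖ ≤ r := by
    have := norm_charFun_le_exp hm hv h3 s
    rwa [hε, abs_of_nonneg hs0, mul_assoc 0.4 _ s, hεs, ← mul_assoc] at this
  have h2 : ‖Complex.exp (-(s ^ 2 / 2))‖ ≤ r := by
    rw [Complex.norm_exp, hr]
    gcongr
    have e : -((s : ℂ) ^ 2 / 2) = ((-(s ^ 2 / 2) : ℝ) : ℂ) := by push_cast; ring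
    rw [e, Complex.ofReal_re, neg_le_neg_iff]
    have : 0 ≤ 0.4 * ε * t := by positivity
    nlinarith [sq_nonneg s]
  have h3' : ‖charFun ν s - Complex.exp (-(s ^ 2 / 2))‖ ≤ ε * √N * s ^ 3 / 6 + s ^ 4 / 8 := by
    have a1 := norm_charFun_sub_taylor_two_le hm hv h3 s
    rw [hε, abs_of_nonneg hs0] at a1
    have a2 : ‖(1 - s ^ 2 / 2 : ℂ) - Complex.exp (-(s ^ 2 / 2))‖ ≤ s ^ 4 / 8 := by
      have := abs_exp_neg_sub_one_sub_le (y := s ^ 2 / 2) (by positivity)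
      rw [abs_sub_comm, ← norm_eq_abs, ← Complex.norm_real] at this
      push_cast at this
      refine this.trans (le_of_eq ?_)
      ring
    calc _ ≤ _ := norm_sub_le_norm_sub_add_norm_sub _ (1 - s ^ 2 / 2 : ℂ) _
      _ ≤ _ := add_le_add a1 a2
  have h4 := norm_pow_sub_pow_le h1 h2 k
  have e1 : Complex.exp (-(s ^ 2 / 2)) ^ (k + 1) = Complex.exp (-(t ^ 2 / 2)) := by
    rw [← Complex.exp_nat_mul]
    congr 1
    have : ((s ^ 2 * N : ℝ) : ℂ) = ((t ^ 2 : ℝ) : ℂ) := by rw [hst]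
    rw [hN] at this
    push_cast at this ⊢
    linear_combination (-1 / 2 : ℂ) * this
  rw [e1] at h4
  refine h4.trans ?_
  -- One factor is spent on the difference, leaving the share 1 - 1/N of the full exponent; 1/N ≤ ε²
  -- makes the loss depend on ε only.
  have e2 : r ^ k ≤ exp (- ((1 - ε ^ 2) * (t ^ 2 / 2 * (1 - 0.4 * ε * t)))) := by
    rw [hr, ← exp_nat_mul]
    gcongr
    have hk : (k : ℝ) = N - 1 := by rw [hN]; push_cast; ring
    have e : (k : ℝ) * -(s ^ 2 / 2 * (1 - 0.4 * ε * t))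
        = -((1 - 1 / N) * (t ^ 2 / 2 * (1 - 0.4 * ε * t))) := by
      rw [hk, ← hst]; field_simp
    rw [e, neg_le_neg_iff]
    gcongr
  have e3 : ((k : ℝ) + 1) * (ε * √N * s ^ 3 / 6 + s ^ 4 / 8)
      ≤ ε * t ^ 3 / 6 + ε ^ 2 * t ^ 4 / 8 := by
    have hk : (k : ℝ) + 1 = N := by rw [hN]; push_cast; ring
    have a1 : N * (ε * √N * s ^ 3 / 6) = ε * t ^ 3 / 6 := by
      linear_combination (s ^ 2 * N / 6) * hεs + (ε * t / 6) * hst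
    have a2 : N * s ^ 4 = t ^ 4 * (1 / N) := by
      rw [show t ^ 4 = (t ^ 2) ^ 2 by ring, ← hst]; field_simp
    have a3 : t ^ 4 * (1 / N) ≤ t ^ 4 * ε ^ 2 := by gcongr
    rw [hk]
    linarith
  calc _ ≤ ((k : ℝ) + 1) * (ε * √N * s ^ 3 / 6 + s ^ 4 / 8) * r ^ k := by gcongr
    _ ≤ _ := by gcongr

end Power

/-! ### The standard normal distribution function -/

lemma gaussianPDFReal_zero_one (x : ℝ) :
    gaussianPDFReal 0 1 x = 1 / √(2 * π) * exp (-(x ^ 2) / 2) := by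
  simp [gaussianPDFReal]

lemma stdNormalCDF_eq_integral (z : ℝ) :
    stdNormalCDF z = ∫ x in Iic z, gaussianPDFReal 0 1 x := by
  simp_rw [stdNormalCDF, gaussianPDFReal_zero_one]

lemma gaussianReal_real_Iic (z : ℝ) : (gaussianReal 0 1).real (Iic z) = stdNormalCDF z := by
  rw [measureReal_def, gaussianReal_apply_eq_integral 0 one_ne_zero, stdNormalCDF_eq_integral,
    ENNReal.toReal_ofReal (integral_nonneg fun x => gaussianPDFReal_nonneg 0 1 x)]

lemma stdNormalCDF_neg (z : ℝ) : stdNormalCDF (-z) = 1 - stdNormalCDF z := by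
  rw [stdNormalCDF_eq_integral, stdNormalCDF_eq_integral, ← integral_gaussianPDFReal_eq_one 0
    (one_ne_zero : (1 : NNReal) ≠ 0), ← intervalIntegral.integral_Iic_add_Ioi (b := z)
    (integrable_gaussianPDFReal 0 1).integrableOn (integrable_gaussianPDFReal 0 1).integrableOn,
    add_sub_cancel_left, ← neg_neg z, ← integral_comp_neg_Iic, neg_neg]
  simp_rw [gaussianPDFReal_zero_one, neg_sq]

lemma stdNormalCDF_eq_half_add (z : ℝ) :
    stdNormalCDF z = 1 / 2 + ∫ x in (0 : ℝ)..z, gaussianPDFReal 0 1 x := by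
  have h0 : stdNormalCDF 0 = 1 / 2 := by
    have := stdNormalCDF_neg 0
    rw [neg_zero] at this
    linarith
  rw [← intervalIntegral.integral_Iic_sub_Iic (integrable_gaussianPDFReal 0 1).integrableOn
    (integrable_gaussianPDFReal 0 1).integrableOn, ← stdNormalCDF_eq_integral,
    ← stdNormalCDF_eq_integral, h0]
  ring

lemma stdNormalCDF_nonneg (z : ℝ) : 0 ≤ stdNormalCDF z := by
  rw [← gaussianReal_real_Iic]; exact measureReal_nonneg

lemma gaussianPDFReal_zero_one_le (x : ℝ) : gaussianPDFReal 0 1 x ≤ 0.399 := by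
  rw [gaussianPDFReal_zero_one]
  have h1 : exp (-(x ^ 2) / 2) ≤ 1 := exp_le_one_iff.2 (by nlinarith [sq_nonneg x])
  have h2 : (2.5065 : ℝ) ≤ √(2 * π) := le_sqrt_of_sq_le (by nlinarith [pi_gt_d4])
  have h3 : 1 / √(2 * π) ≤ 0.399 := by
    rw [div_le_iff₀ (by linarith)]
    linarith
  have : 0 < 1 / √(2 * π) := by positivity
  nlinarith [exp_pos (-(x ^ 2) / 2)]

lemma half_sub_le_stdNormalCDF_neg {a : ℝ} (ha : 0 ≤ a) :
    1 / 2 - 0.399 * a ≤ stdNormalCDF (-a) := by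
  rw [stdNormalCDF_neg, stdNormalCDF_eq_half_add]
  have : ∫ x in (0 : ℝ)..a, gaussianPDFReal 0 1 x ≤ ∫ _ in (0 : ℝ)..a, (0.399 : ℝ) :=
    intervalIntegral.integral_mono_on ha (integrable_gaussianPDFReal 0 1).intervalIntegrable
      (by simp) fun x _ => gaussianPDFReal_zero_one_le x
  rw [intervalIntegral.integral_const, smul_eq_mul] at this
  linarith

lemma half_le_stdNormalCDF {z : ℝ} (hz : 0 ≤ z) : 1 / 2 ≤ stdNormalCDF z := by
  rw [stdNormalCDF_eq_half_add]
  have := intervalIntegral.integral_nonneg hz (μ := volume)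
    fun x _ => gaussianPDFReal_nonneg 0 1 x
  linarith

lemma integrable_exp_neg_sq_div_two : Integrable (fun t : ℝ => exp (-(t ^ 2 / 2))) := by
  refine (integrable_exp_neg_mul_sq (b := 1 / 2) (by norm_num)).congr
    (Eventually.of_forall fun t => ?_)
  simp only
  ring_nf

lemma integral_cos_mul_exp_neg_sq (x : ℝ) :
    ∫ t in Ioi (0 : ℝ), cos (x * t) * exp (-(t ^ 2 / 2)) = π * gaussianPDFReal 0 1 x := by
  have h1 : ∫ t, gaussianPDFReal 0 1 t * cos (x * t) = exp (-(x ^ 2 / 2)) := by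
    have h := congrArg Complex.re (charFun_gaussianReal (μ := 0) (v := 1) x)
    have ie : Integrable (fun t : ℝ => Complex.exp (x * t * Complex.I)) (gaussianReal 0 1) := by
      refine (integrable_const (1 : ℝ)).mono' (by fun_prop) (Eventually.of_forall fun x => ?_)
      rw [← Complex.ofReal_mul, Complex.norm_exp_ofReal_mul_I]
    rw [charFun_apply_real, ← Complex.reCLM_apply, ← Complex.reCLM.integral_comp_comm ie,
      integral_gaussianReal_eq_integral_smul one_ne_zero] at h
    have e : (Complex.exp (x * (0 : ℝ) * Complex.I - ((1 : NNReal) : ℝ) * (x : ℂ) ^ 2 / 2)).re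
        = exp (-(x ^ 2 / 2)) := by
      rw [← Complex.exp_ofReal_re]
      congr 2
      push_cast
      ring
    rw [e] at h
    rw [← h]
    refine integral_congr_ae (Eventually.of_forall fun t => ?_)
    simp only [Complex.reCLM_apply, ← Complex.ofReal_mul, Complex.exp_ofReal_mul_I_re, smul_eq_mul]
  have h2 := integral_comp_abs (f := fun t => gaussianPDFReal 0 1 t * cos (x * t))
  have h3 (t : ℝ) : gaussianPDFReal 0 1 |t| * cos (x * |t|) = gaussianPDFReal 0 1 t * cos (x * t) := by
    rw [gaussianPDFReal_zero_one, gaussianPDFReal_zero_one, sq_abs, ← cos_abs (x * |t|),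
      abs_mul, abs_abs, ← abs_mul, cos_abs]
  simp_rw [h3] at h2
  rw [h1] at h2
  have h4 : ∫ t in Ioi (0 : ℝ), gaussianPDFReal 0 1 t * cos (x * t)
      = 1 / √(2 * π) * ∫ t in Ioi (0 : ℝ), cos (x * t) * exp (-(t ^ 2 / 2)) := by
    rw [← integral_const_mul]
    refine integral_congr_ae (Eventually.of_forall fun t => ?_)
    simp only
    rw [gaussianPDFReal_zero_one, neg_div]
    ring
  rw [h4] at h2
  rw [gaussianPDFReal_zero_one, neg_div, h2]
  have h5 : √(2 * π) ^ 2 = 2 * π := sq_sqrt (by positivity)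
  have h6 : √(2 * π) ≠ 0 := by positivity
  field_simp
  rw [h5]
  field_simp

/-- Fourier inversion of the density, integrated over [0, z] under the integral sign. -/
lemma stdNormalCDF_eq_half_add_integral (z : ℝ) :
    stdNormalCDF z =
      1 / 2 + ∫ t in Ioi (0 : ℝ), 1 / (π * t) * (sin (z * t) * exp (-(t ^ 2 / 2))) := by
  have hswap := intervalIntegral_integral_swap (a := 0) (b := z)
    (μ := volume.restrict (Ioi (0 : ℝ)))
    (f := fun x t => cos (x * t) * exp (-(t ^ 2 / 2))) (by
      have : Integrable (fun p : ℝ × ℝ => (1 : ℝ) * exp (-(p.2 ^ 2 / 2)))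
          ((volume.restrict (uIoc 0 z)).prod (volume.restrict (Ioi (0 : ℝ)))) :=
        haveI : IsFiniteMeasure (volume.restrict (uIoc 0 z)) := ⟨by simp [uIoc]⟩
        (integrable_const 1).mul_prod integrable_exp_neg_sq_div_two.restrict
      refine this.mono' (Continuous.aestronglyMeasurable (by fun_prop))
        (Eventually.of_forall fun p => ?_)
      simp only [Function.uncurry, norm_mul, norm_eq_abs, abs_exp]
      gcongr
      exact abs_cos_le_one _)
  rw [stdNormalCDF_eq_half_add]
  congr 1
  have h1 : ∫ x in (0 : ℝ)..z, gaussianPDFReal 0 1 x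
      = 1 / π * ∫ x in (0 : ℝ)..z, ∫ t in Ioi (0 : ℝ), cos (x * t) * exp (-(t ^ 2 / 2)) := by
    rw [← intervalIntegral.integral_const_mul]
    refine intervalIntegral.integral_congr fun x _ => ?_
    rw [integral_cos_mul_exp_neg_sq]
    field_simp
  rw [h1, hswap, ← integral_const_mul]
  refine setIntegral_congr_fun measurableSet_Ioi fun t ht => ?_
  have ht' : t ≠ 0 := (mem_Ioi.1 ht).ne'
  rw [intervalIntegral.integral_mul_const, intervalIntegral.integral_comp_mul_right (fun y => cos y) ht',
    integral_cos]
  simp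
  field_simp

lemma stdNormalCDF_eq_half_add_integral_scaled {T : ℝ} (hT : 0 < T) (z : ℝ) :
    stdNormalCDF z = 1 / 2 +
      ∫ x in Ioi (0 : ℝ), 1 / (π * x) * (sin (z * (T * x)) * exp (-((T * x) ^ 2 / 2))) := by
  rw [stdNormalCDF_eq_half_add_integral]
  congr 1
  have h := integral_comp_mul_left_Ioi
    (fun t => 1 / (π * t) * (sin (z * t) * exp (-(t ^ 2 / 2)))) 0 hT
  rw [mul_zero, smul_eq_mul] at h
  have e : ∫ x in Ioi (0 : ℝ), 1 / (π * x) * (sin (z * (T * x)) * exp (-((T * x) ^ 2 / 2)))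
      = T * ∫ x in Ioi (0 : ℝ), 1 / (π * (T * x)) * (sin (z * (T * x)) * exp (-((T * x) ^ 2 / 2))) := by
    rw [← integral_const_mul]
    refine integral_congr_ae (Eventually.of_forall fun x => ?_)
    simp only
    field_simp
  rw [e, h, ← mul_assoc, mul_inv_cancel₀ hT.ne', one_mul]

/-! ### The smoothing inequality -/

lemma mul_add_mul_le_of_sq_le {a b k p q r : ℝ} (hk : 0 ≤ k) (hr : 0 ≤ r)
    (hab : a ^ 2 + b ^ 2 ≤ k ^ 2) (hpq : p ^ 2 + q ^ 2 ≤ r ^ 2) : a * p + b * q ≤ k * r := by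
  refine le_of_sq_le_sq ?_ (mul_nonneg hk hr)
  calc (a * p + b * q) ^ 2 ≤ (a ^ 2 + b ^ 2) * (p ^ 2 + q ^ 2) := by
        nlinarith [sq_nonneg (a * q - b * p)]
    _ ≤ k ^ 2 * r ^ 2 := by gcongr
    _ = (k * r) ^ 2 := by ring

lemma re_im_le {a b k r : ℝ} {w : ℂ} (hk : 0 ≤ k) (hab : a ^ 2 + b ^ 2 ≤ k ^ 2) (hw : ‖w‖ ≤ r) :
    a * w.re + b * w.im ≤ k * r := by
  refine (mul_add_mul_le_of_sq_le hk (norm_nonneg w) hab (le_of_eq ?_)).trans (by gcongr)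
  rw [← Complex.normSq_eq_norm_sq, Complex.normSq_apply]
  ring

section Smoothing

variable (ν : Measure ℝ) (T z : ℝ)

/-- The integrand of Beurling's majorant, centred at `z` and rescaled by `T`. -/
noncomputable def beurlingIntegrand (x s : ℝ) : ℝ :=
  (1 - x) * cos (T * (z - s) * x) + sineWeight x * sin (T * (z - s) * x)

/-- The characteristic function of `z - S` at `T * x`, where `S` has law `ν`. -/
noncomputable def shiftedCharFun (x : ℝ) : ℂ :=
  Complex.exp ((z * (T * x) : ℝ) * Complex.I) * charFun ν (-(T * x))

variable {ν} [IsProbabilityMeasure ν]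

/-- The weight has a pole of order 1/x at 0, compensated by |sin(T(z - s)x)| ≤ T|z - s|x; the
resulting bound grows linearly in s, hence the first moment. -/
lemma integrable_beurlingIntegrand (hT : 0 < T) (hν : Integrable (fun s => s) ν) :
    Integrable (Function.uncurry (beurlingIntegrand T z))
      ((volume.restrict (uIoc (0 : ℝ) 1)).prod ν) := by
  have : IsFiniteMeasure (volume.restrict (uIoc (0 : ℝ) 1)) := ⟨by simp [uIoc]⟩
  have hb : Integrable (fun p : ℝ × ℝ => (1 : ℝ) * (1 + (T * |z - p.2| / 2 + 1 / π)))
      ((volume.restrict (uIoc (0 : ℝ) 1)).prod ν) :=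
    (integrable_const 1).mul_prod ((integrable_const 1).add
      (((((integrable_const z).sub hν).abs.const_mul T).div_const 2).add (integrable_const (1 / π))))
  have hs := measurable_sineWeight
  refine hb.mono' (Measurable.aestronglyMeasurable ?_) ?_
  · unfold Function.uncurry beurlingIntegrand
    fun_prop
  · have hprod : (volume.restrict (uIoc (0 : ℝ) 1)).prod ν
        = (volume.prod ν).restrict (uIoc (0 : ℝ) 1 ×ˢ univ) := by
      rw [← Measure.prod_restrict, Measure.restrict_univ]
    rw [hprod]
    refine (ae_restrict_mem (measurableSet_uIoc.prod MeasurableSet.univ)).mono fun p hp => ?_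
    obtain ⟨x, s⟩ := p
    have hx : x ∈ Ioc (0 : ℝ) 1 := by
      have := hp.1
      rwa [uIoc_of_le zero_le_one] at this
    simp only [Function.uncurry, beurlingIntegrand, norm_eq_abs, one_mul]
    refine (abs_add_le _ _).trans (add_le_add ?_ ?_)
    · rw [abs_mul]
      have h1 : |1 - x| ≤ 1 := by rw [abs_le]; constructor <;> linarith [hx.1, hx.2]
      have := abs_cos_le_one (T * (z - s) * x)
      nlinarith [abs_nonneg (1 - x), abs_nonneg (cos (T * (z - s) * x))]
    · rw [sineWeight, add_mul]
      refine (abs_add_le _ _).trans (add_le_add ?_ ?_)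
      · rcases hx.2.eq_or_lt with h | h
        · subst h
          simp
          positivity
        · refine abs_one_sub_mul_cot_mul_le hx.1 h (abs_sin_le_abs.trans (le_of_eq ?_))
          rw [abs_mul, abs_mul, abs_of_pos hT, abs_of_pos hx.1]
          ring
      · rw [abs_mul, abs_of_pos (by positivity : 0 < 1 / π)]
        have := abs_sin_le_one (T * (z - s) * x)
        have : 0 < 1 / π := by positivity
        nlinarith

lemma integral_beurlingIntegrand (x : ℝ) :
    ∫ s, beurlingIntegrand T z x s ∂ν
      = (1 - x) * (shiftedCharFun ν T z x).re + sineWeight x * (shiftedCharFun ν T z x).im := by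
  have ic : Integrable (fun s => cos (T * (z - s) * x)) ν :=
    (integrable_const (1 : ℝ)).mono' (by fun_prop)
      (Eventually.of_forall fun x => abs_cos_le_one _)
  have is : Integrable (fun s => sin (T * (z - s) * x)) ν :=
    (integrable_const (1 : ℝ)).mono' (by fun_prop)
      (Eventually.of_forall fun x => abs_sin_le_one _)
  have ie : Integrable (fun s : ℝ => Complex.exp ((T * (z - s) * x : ℝ) * Complex.I)) ν := by
    refine (integrable_const (1 : ℝ)).mono' (by fun_prop) (Eventually.of_forall fun x => ?_)
    rw [Complex.norm_exp_ofReal_mul_I]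
  have e : shiftedCharFun ν T z x = ∫ s, Complex.exp ((T * (z - s) * x : ℝ) * Complex.I) ∂ν := by
    rw [shiftedCharFun, charFun_apply_real, ← integral_const_mul]
    refine integral_congr_ae (Eventually.of_forall fun s => ?_)
    simp only
    rw [← Complex.exp_add]
    congr 1
    push_cast
    ring
  simp only [beurlingIntegrand]
  rw [integral_add (ic.const_mul _) (is.const_mul _), integral_const_mul, integral_const_mul, e,
    ← Complex.reCLM_apply, ← Complex.imCLM_apply, ← Complex.reCLM.integral_comp_comm ie,
    ← Complex.imCLM.integral_comp_comm ie]
  simp only [Complex.reCLM_apply, Complex.imCLM_apply, Complex.exp_ofReal_mul_I_re,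
    Complex.exp_ofReal_mul_I_im]

lemma intervalIntegrable_shiftedCharFun (hT : 0 < T) (hν : Integrable (fun s => s) ν) :
    IntervalIntegrable (fun x => (1 - x) * (shiftedCharFun ν T z x).re
      + sineWeight x * (shiftedCharFun ν T z x).im) volume 0 1 := by
  rw [intervalIntegrable_iff]
  refine (integrable_beurlingIntegrand T z hT hν).integral_prod_left.congr
    (Eventually.of_forall fun x => ?_)
  exact integral_beurlingIntegrand T z x

lemma measureReal_Iic_le (hT : 0 < T) (hν : Integrable (fun s => s) ν) :
    ν.real (Iic z) ≤ 1 / 2 + ∫ x in (0 : ℝ)..1, ((1 - x) * (shiftedCharFun ν T z x).re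
      + sineWeight x * (shiftedCharFun ν T z x).im) := by
  have hint := integrable_beurlingIntegrand T z hT hν
  have hb (s : ℝ) : beurling (T * (z - s) / (2 * π))
      = 1 / 2 + ∫ x in (0 : ℝ)..1, beurlingIntegrand T z x s := by
    rw [beurling]
    congr 1
    refine intervalIntegral.integral_congr fun x _ => ?_
    have : 2 * π * (T * (z - s) / (2 * π)) * x = T * (z - s) * x := by field_simp
    simp only [this, beurlingIntegrand]
  have hi : Integrable (fun s => ∫ x in (0 : ℝ)..1, beurlingIntegrand T z x s) ν := by
    simp_rw [intervalIntegral.integral_of_le (zero_le_one' ℝ)]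
    rw [uIoc_of_le zero_le_one] at hint
    exact hint.integral_prod_right
  calc ν.real (Iic z) = ∫ s, (Iic z).indicator 1 s ∂ν := by
        rw [integral_indicator_one measurableSet_Iic]
    _ ≤ ∫ s, (1 / 2 + ∫ x in (0 : ℝ)..1, beurlingIntegrand T z x s) ∂ν := by
        refine integral_mono ((integrable_const 1).indicator measurableSet_Iic)
          ((integrable_const _).add hi) fun s => ?_
        simp only
        rw [← hb]
        refine le_trans (le_of_eq ?_) (indicator_Ici_le_beurling _)
        have : s ∈ Iic z ↔ T * (z - s) / (2 * π) ∈ Ici (0 : ℝ) := by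
          rw [mem_Iic, mem_Ici, le_div_iff₀ two_pi_pos, zero_mul, mul_nonneg_iff_of_pos_left hT,
            sub_nonneg]
        by_cases h : s ∈ Iic z
        · rw [indicator_of_mem h, indicator_of_mem (this.1 h)]; simp
        · rw [indicator_of_notMem h, indicator_of_notMem (mt this.2 h)]
    _ = _ := by
        rw [integral_add (integrable_const _) hi, ← intervalIntegral_integral_swap hint]
        simp only [integral_beurlingIntegrand]
        simp

lemma integrable_exp_neg_sq_scaled {T : ℝ} (hT : 0 < T) :
    Integrable (fun x : ℝ => exp (-((T * x) ^ 2 / 2))) := by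
  refine (integrable_exp_neg_mul_sq (b := T ^ 2 / 2) (by positivity)).congr
    (Eventually.of_forall fun t => ?_)
  simp only
  ring_nf

lemma integral_exp_neg_sq_scaled {T : ℝ} (hT : 0 < T) :
    ∫ x in Ioi (0 : ℝ), exp (-((T * x) ^ 2 / 2)) = √(π / 2) / T := by
  have h := integral_gaussian_Ioi (T ^ 2 / 2)
  have e : √(π / (T ^ 2 / 2)) = 2 * (√(π / 2) / T) := by
    rw [show π / (T ^ 2 / 2) = (π / 2) * (2 / T) ^ 2 by field_simp,
      sqrt_mul (by positivity), sqrt_sq (by positivity)]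
    ring
  rw [e, mul_div_cancel_left₀ _ two_ne_zero] at h
  rw [← h]
  refine integral_congr_ae (Eventually.of_forall fun t => ?_)
  simp only
  ring_nf

/-- The inversion integral of the normal law continues beyond the cutoff x = 1, and there its
negative is at most the Gaussian `g` because πx > 1. The same `g` is allowed below the cutoff in
`h`, so both costs combine into the integral of `g` over the half-line, √(π/2)/T. -/
theorem measureReal_Iic_le_stdNormalCDF_add (hT : 0 < T) (hν : Integrable (fun s => s) ν)
    {N : ℝ → ℝ} (hN : IntervalIntegrable N volume 0 1)
    (h : ∀ x, 0 < x → x < 1 → (1 - x) * (shiftedCharFun ν T z x).re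
      + sineWeight x * (shiftedCharFun ν T z x).im
      - 1 / (π * x) * (sin (z * (T * x)) * exp (-((T * x) ^ 2 / 2)))
        ≤ exp (-((T * x) ^ 2 / 2)) + N x) :
    ν.real (Iic z) ≤ stdNormalCDF z + √(π / 2) / T + ∫ x in (0 : ℝ)..1, N x := by
  set g : ℝ → ℝ := fun x => exp (-((T * x) ^ 2 / 2)) with hg
  set p : ℝ → ℝ := fun x => 1 / (π * x) * (sin (z * (T * x)) * exp (-((T * x) ^ 2 / 2))) with hp
  set q : ℝ → ℝ := fun x => (1 - x) * (shiftedCharFun ν T z x).re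
      + sineWeight x * (shiftedCharFun ν T z x).im with hq
  have gi : Integrable g := integrable_exp_neg_sq_scaled hT
  have pi : IntegrableOn p (Ioi 0) := by
    refine ((gi.const_mul (|z| * T / π)).restrict (s := Ioi 0)).mono'
      (Measurable.aestronglyMeasurable (by fun_prop))
      ((ae_restrict_mem measurableSet_Ioi).mono fun x hx => ?_)
    have hx0 : 0 < x := hx
    have h1 : |sin (z * (T * x))| ≤ |z| * (T * x) := by
      refine abs_sin_le_abs.trans (le_of_eq ?_)
      rw [abs_mul, abs_of_pos (mul_pos hT hx0)]
    simp only [hp, hg, norm_mul, norm_eq_abs, abs_exp]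
    rw [abs_of_pos (by positivity : 0 < 1 / (π * x))]
    calc _ ≤ 1 / (π * x) * (|z| * (T * x) * exp (-((T * x) ^ 2 / 2))) := by gcongr
      _ = _ := by field_simp
  have qi : IntervalIntegrable q volume 0 1 := intervalIntegrable_shiftedCharFun T z hT hν
  have pi01 : IntervalIntegrable p volume 0 1 := by
    rw [intervalIntegrable_iff_integrableOn_Ioc_of_le zero_le_one]
    exact pi.mono_set Ioc_subset_Ioi_self
  have gi01 : IntervalIntegrable g volume 0 1 := gi.intervalIntegrable
  have pi1 : IntegrableOn p (Ioi 1) := pi.mono_set (Ioi_subset_Ioi zero_le_one)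
  have h1 : ν.real (Iic z) ≤ 1 / 2 + ∫ x in (0 : ℝ)..1, q x := measureReal_Iic_le T z hT hν
  have h2 : stdNormalCDF z = 1 / 2 + ∫ x in Ioi (0 : ℝ), p x :=
    stdNormalCDF_eq_half_add_integral_scaled hT z
  have h3 : ∫ x in Ioi (0 : ℝ), p x = (∫ x in (0 : ℝ)..1, p x) + ∫ x in Ioi (1 : ℝ), p x :=
    (intervalIntegral.integral_interval_add_Ioi pi pi1).symm
  have h4 : ∫ x in Ioi (0 : ℝ), g x = (∫ x in (0 : ℝ)..1, g x) + ∫ x in Ioi (1 : ℝ), g x :=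
    (intervalIntegral.integral_interval_add_Ioi gi.integrableOn gi.integrableOn).symm
  have h5 : ∫ x in Ioi (0 : ℝ), g x = √(π / 2) / T := integral_exp_neg_sq_scaled hT
  have h6 : - ∫ x in Ioi (1 : ℝ), p x ≤ ∫ x in Ioi (1 : ℝ), g x := by
    rw [← integral_neg]
    refine setIntegral_mono_on pi1.neg gi.integrableOn measurableSet_Ioi fun x hx => ?_
    have hx1 : 1 < x := hx
    have e : 1 / (π * x) ≤ 1 := by
      rw [div_le_one (by positivity)]
      nlinarith [pi_gt_three]
    have e0 : 0 < 1 / (π * x) := by positivity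
    have e1 := neg_one_le_sin (z * (T * x))
    have e2 := exp_pos (-((T * x) ^ 2 / 2))
    have e3 : 1 / (π * x) * -sin (z * (T * x)) ≤ 1 := by nlinarith
    have : -p x = (1 / (π * x) * -sin (z * (T * x))) * g x := by simp only [hp, hg]; ring
    rw [this]
    nlinarith
  have h7 : (∫ x in (0 : ℝ)..1, q x) - ∫ x in (0 : ℝ)..1, p x
      ≤ (∫ x in (0 : ℝ)..1, g x) + ∫ x in (0 : ℝ)..1, N x := by
    rw [← intervalIntegral.integral_sub qi pi01, ← intervalIntegral.integral_add gi01 hN]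
    exact intervalIntegral.integral_mono_on_of_le_Ioo zero_le_one (qi.sub pi01) (gi01.add hN)
      fun x hx => h x hx.1 hx.2
  linarith

end Smoothing

/-! ### A fixed-point upper bound for the remainder of the smoothing inequality -/

/-- A natural number at least `10 ^ 9 * exp (-(8 * a / b))`. -/
def expNegBound (a b : ℕ) : ℕ :=
  let D := 1000000000
  let w := D * a / b
  let e₀ := D * D / (D + w + w * w / (2 * D) + w * w * w / (6 * (D * D))) + 1
  let e₁ := e₀ * e₀ / D + 1
  let e₂ := e₁ * e₁ / D + 1
  e₂ * e₂ / D + 1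

lemma div_le_div_add_one (m n : ℕ) : (m : ℝ) / n ≤ ((m / n + 1 : ℕ) : ℝ) := by
  have := Nat.lt_floor_add_one ((m : ℝ) / n)
  rw [Nat.floor_div_eq_div] at this
  push_cast
  exact this.le

lemma sq_fixedPoint_le {D : ℕ} {x : ℝ} (hx : 0 ≤ x) {e : ℕ} (hD : 0 < D) (h : x * D ≤ e) :
    x ^ 2 * D ≤ ((e * e / D + 1 : ℕ) : ℝ) := by
  refine le_trans ?_ (div_le_div_add_one _ _)
  have hD' : (0 : ℝ) < D := by exact_mod_cast hD
  rw [le_div_iff₀ hD']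
  push_cast
  calc x ^ 2 * D * D = (x * D) * (x * D) := by ring
    _ ≤ e * e := by gcongr

/-- The cubic Taylor polynomial bounds exp y from below, all divisions rounding down; its reciprocal
and the three squarings producing exp(-8y) round up through the added 1. -/
lemma exp_neg_le_expNegBound (a b : ℕ) :
    exp (-(8 * (a / b : ℝ))) * 1000000000 ≤ expNegBound a b := by
  set D : ℕ := 1000000000 with hD
  have hD0 : (0 : ℝ) < D := by rw [hD]; norm_num
  set w : ℕ := D * a / b with hw
  set y : ℝ := (a / b : ℝ) with hy
  have hy0 : 0 ≤ y := by positivity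
  have hwy : (w : ℝ) / D ≤ y := by
    rw [div_le_iff₀ hD0]
    calc (w : ℝ) ≤ ((D * a : ℕ) : ℝ) / b := Nat.cast_div_le
      _ = _ := by rw [hy]; push_cast; ring
  set v : ℕ := D + w + w * w / (2 * D) + w * w * w / (6 * (D * D)) with hv
  have hv0 : 0 < v := by rw [hv, hD]; positivity
  have hvy : (v : ℝ) / D ≤ exp y := by
    have h1 : ((w * w / (2 * D) : ℕ) : ℝ) ≤ w * w / (2 * D) := by
      refine Nat.cast_div_le.trans (le_of_eq ?_); push_cast; ring
    have h2 : ((w * w * w / (6 * (D * D)) : ℕ) : ℝ) ≤ w * w * w / (6 * (D * D)) := by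
      refine Nat.cast_div_le.trans (le_of_eq ?_); push_cast; ring
    have h3 : (v : ℝ) ≤ D + w + w * w / (2 * D) + w * w * w / (6 * (D * D)) := by
      rw [hv]; push_cast; linarith
    have h4 := Real.sum_le_exp_of_nonneg (x := (w : ℝ) / D) (by positivity) 4
    simp only [Finset.sum_range_succ, Finset.sum_range_zero, Nat.factorial] at h4
    refine le_trans ?_ (h4.trans (exp_le_exp.2 hwy))
    rw [div_le_iff₀ hD0]
    refine h3.trans (le_of_eq ?_)
    push_cast
    field_simp
    ring
  have he : exp (-y) * D ≤ ((D * D / v + 1 : ℕ) : ℝ) := by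
    refine le_trans ?_ (div_le_div_add_one _ _)
    have hv0' : (0 : ℝ) < v := by exact_mod_cast hv0
    rw [le_div_iff₀ hv0', exp_neg]
    have : (v : ℝ) ≤ exp y * D := by rwa [div_le_iff₀ hD0] at hvy
    calc (exp y)⁻¹ * D * v ≤ (exp y)⁻¹ * D * (exp y * D) := by gcongr
      _ = ((D * D : ℕ) : ℝ) := by push_cast; field_simp
  have hD1 : 0 < D := by rw [hD]; norm_num
  have h8 : exp (-(8 * y)) = ((exp (-y) ^ 2) ^ 2) ^ 2 := by
    rw [← pow_mul, ← pow_mul, ← exp_nat_mul]; congr 1; push_cast; ring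
  have key := sq_fixedPoint_le (by positivity) hD1 (sq_fixedPoint_le (by positivity) hD1
    (sq_fixedPoint_le (exp_pos _).le hD1 he))
  rw [h8]
  exact_mod_cast key

/-- The factor by which the difference of the characteristic functions, respectively the
characteristic function itself, enters the smoothing inequality at frequency `5 x / (2 ε)`. -/
noncomputable def smoothingRemainder (ε x : ℝ) : ℝ :=
  if x ≤ 2 / 5 then
    0.335 * (125 / 48 * x ^ 2 + 625 / 128 * x ^ 3) / ε ^ 2 *
      exp (-((1 - ε ^ 2) * (25 / 8 * x ^ 2 * (1 - x)) / ε ^ 2))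
  else if x ≤ 1 / 2 then 0.335 / x * exp (-(25 / 8 * x ^ 2 * (1 - x) / ε ^ 2))
  else 1.28 * (1 - x) * exp (-(25 / 8 * x ^ 2 * (1 - x) / ε ^ 2))

lemma measurable_smoothingRemainder (ε : ℝ) : Measurable (smoothingRemainder ε) := by
  unfold smoothingRemainder
  refine Measurable.ite measurableSet_Iic (by fun_prop)
    (Measurable.ite measurableSet_Iic (by fun_prop) (by fun_prop))

lemma intervalIntegrable_smoothingRemainder {ε : ℝ} (h1 : ε ^ 2 ≤ 1) :
    IntervalIntegrable (smoothingRemainder ε) volume 0 1 := by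
  rw [intervalIntegrable_iff_integrableOn_Ioc_of_le zero_le_one]
  refine Measure.integrableOn_of_bounded (M := 3 / ε ^ 2 + 2) (by simp)
    (measurable_smoothingRemainder ε).aestronglyMeasurable
    ((ae_restrict_mem measurableSet_Ioc).mono fun x hx => ?_)
  have hx0 : 0 < x := hx.1
  have hx1 : 0 ≤ 1 - x := by linarith [hx.2]
  have hA : 0 ≤ 25 / 8 * x ^ 2 * (1 - x) := by positivity
  have he : exp (-(25 / 8 * x ^ 2 * (1 - x) / ε ^ 2)) ≤ 1 := exp_le_one_iff.2 (by
    rw [neg_nonpos]; positivity)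
  have he' : exp (-((1 - ε ^ 2) * (25 / 8 * x ^ 2 * (1 - x)) / ε ^ 2)) ≤ 1 := exp_le_one_iff.2 (by
    rw [neg_nonpos]
    have : 0 ≤ 1 - ε ^ 2 := by linarith
    positivity)
  have hε2 : 0 ≤ 3 / ε ^ 2 := by positivity
  unfold smoothingRemainder
  split_ifs with c1 c2
  · rw [norm_of_nonneg (by positivity)]
    have : 0.335 * (125 / 48 * x ^ 2 + 625 / 128 * x ^ 3) ≤ 3 := by
      have a1 : x ^ 2 ≤ 1 := pow_le_one₀ hx0.le hx.2
      have a2 : x ^ 3 ≤ 1 := pow_le_one₀ hx0.le hx.2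
      linarith
    calc _ ≤ 3 / ε ^ 2 * 1 := by gcongr
      _ ≤ _ := by linarith
  · rw [norm_of_nonneg (by positivity)]
    have : 0.335 / x ≤ 1 := by rw [div_le_one hx0]; linarith
    calc _ ≤ (1 : ℝ) * 1 := by gcongr
      _ ≤ _ := by linarith
  · rw [norm_of_nonneg (by positivity)]
    calc _ ≤ 1.28 * (1 - 0) * (1 : ℝ) := by gcongr
      _ ≤ _ := by linarith

/-- An upper bound, in units of `10⁻¹⁸`, for the integral of `smoothingRemainder ε` over the cell
`[i / 100, (i + 1) / 100]`, uniformly in `ε ∈ [j / 100, (j + 1) / 100]`. -/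
def cellBound (j i : ℕ) : ℕ :=
  let q := (j + 1) * (j + 1)
  let p := 25 * (i * i * (99 - i))
  if i < 40 then
    (335 * 1000000000 * (4000 * (i + 1) ^ 2 + 75 * (i + 1) ^ 3) / (153600000 * (j * j)) + 1) *
      expNegBound (p * (10000 - q)) (64000000 * q)
  else if i < 50 then
    (335000000 / i + 1) * expNegBound (p * 10000) (64000000 * q)
  else 128000 * (100 - i) * expNegBound (p * 10000) (64000000 * q)

/-- The sum of the first `n` cell bounds. -/
def cellSum (j : ℕ) : ℕ → ℕ
  | 0 => 0
  | n + 1 => cellSum j n + cellBound j n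

lemma cellSum_eq (j n : ℕ) : cellSum j n = ∑ i ∈ Finset.range n, cellBound j i := by
  induction n with
  | zero => rfl
  | succ n ih => rw [cellSum, ih, Finset.sum_range_succ]

/-- The finite check for ε from 0.20 to 0.71, one cell of width 1/100 for each value of `k + 20`.
The right side is 0.2686 ε at the left end of the cell, in units of 10⁻¹⁸. -/
lemma cellSum_le : ∀ k < 51, cellSum (k + 20) 100 ≤ 2686000000000000 * (k + 20) := by
  decide +kernel

/-- Each monotone factor is evaluated at its worst endpoint: in the exponent, x² at the left, 1 - x
at the right and ε at its largest value. Units are 10⁻¹⁶, made of 10⁻⁹ for the exponential and 10⁻⁷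
for the prefactor; the cell width later contributes 1/100. -/
lemma smoothingRemainder_le_cellBound {ε : ℝ} {j i : ℕ} (hj : 1 ≤ j) (hj' : j < 100)
    (h1 : (j : ℝ) / 100 ≤ ε) (h2 : ε ≤ ((j + 1 : ℕ) : ℝ) / 100) (hi : i < 100) {x : ℝ}
    (hx1 : (i : ℝ) / 100 < x) (hx2 : x < ((i + 1 : ℕ) : ℝ) / 100) :
    smoothingRemainder ε x ≤ (cellBound j i : ℝ) / 10 ^ 16 := by
  have hi0 : (0 : ℝ) ≤ i := by positivity
  have hx0 : 0 < x := lt_of_le_of_lt (by positivity) hx1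
  have hj0 : (0 : ℝ) < (j : ℝ) / 100 := by positivity
  have hε0 : 0 < ε := hj0.trans_le h1
  have hq1 : ((j + 1 : ℕ) : ℝ) ≤ 100 := by exact_mod_cast (by omega : j + 1 ≤ 100)
  set q : ℕ := (j + 1) * (j + 1) with hq
  set p : ℕ := 25 * (i * i * (99 - i)) with hp
  have hqR : (q : ℝ) = ((j + 1 : ℕ) : ℝ) ^ 2 := by rw [hq]; push_cast; ring
  have hq0 : (0 : ℝ) < q := by rw [hqR]; positivity
  have hqle : q ≤ 10000 :=
    (Nat.mul_le_mul (by omega) (by omega) : (j + 1) * (j + 1) ≤ 100 * 100)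
  have hpR : (p : ℝ) = 25 * i ^ 2 * (99 - i) := by
    rw [hp]; push_cast [Nat.cast_sub (by omega : i ≤ 99)]; ring
  have hε2 : ε ^ 2 ≤ q / 10000 := by
    calc ε ^ 2 ≤ (((j + 1 : ℕ) : ℝ) / 100) ^ 2 := by gcongr
      _ = _ := by rw [hqR]; ring
  have hi99 : (i : ℝ) ≤ 99 := by exact_mod_cast (by omega : i ≤ 99)
  have hA : (p : ℝ) / 8000000 ≤ 25 / 8 * x ^ 2 * (1 - x) := by
    have e : (p : ℝ) / 8000000 = 25 / 8 * ((i : ℝ) / 100) ^ 2 * (1 - ((i + 1 : ℕ) : ℝ) / 100) := by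
      rw [hpR]; push_cast; ring
    have : 0 ≤ 1 - ((i + 1 : ℕ) : ℝ) / 100 := by push_cast; linarith
    rw [e]
    gcongr
  have hp0 : (0 : ℝ) ≤ p := by positivity
  have hx1' : 0 ≤ 1 - x := by
    have : ((i + 1 : ℕ) : ℝ) / 100 ≤ 1 := by push_cast; linarith
    linarith
  have hE1 : exp (-((1 - ε ^ 2) * (25 / 8 * x ^ 2 * (1 - x)) / ε ^ 2)) ≤
      (expNegBound (p * (10000 - q)) (64000000 * q) : ℝ) / 1000000000 := by
    rw [le_div_iff₀ (by norm_num)]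
    refine le_trans ?_ (exp_neg_le_expNegBound _ _)
    gcongr
    push_cast [Nat.cast_sub hqle]
    have hqR' : (q : ℝ) ≤ 10000 := by exact_mod_cast hqle
    calc 8 * ((p : ℝ) * (10000 - q) / (64000000 * q))
        = (10000 / q - 1) * (p / 8000000) := by field_simp; ring
      _ ≤ (1 / ε ^ 2 - 1) * (25 / 8 * x ^ 2 * (1 - x)) := by
        have a1 : (10000 : ℝ) / q ≤ 1 / ε ^ 2 := by
          rw [div_le_div_iff₀ hq0 (by positivity)]
          linarith
        have a2 : 1 ≤ (10000 : ℝ) / q := by rw [one_le_div hq0]; exact hqR'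
        have a3 : 0 ≤ 1 / ε ^ 2 - 1 := by linarith
        gcongr
      _ = _ := by field_simp
  have hE2 : exp (-(25 / 8 * x ^ 2 * (1 - x) / ε ^ 2)) ≤
      (expNegBound (p * 10000) (64000000 * q) : ℝ) / 1000000000 := by
    rw [le_div_iff₀ (by norm_num)]
    refine le_trans ?_ (exp_neg_le_expNegBound _ _)
    gcongr
    push_cast
    calc 8 * ((p : ℝ) * 10000 / (64000000 * q)) = (p / 8000000) / (q / 10000) := by
          field_simp; ring
      _ ≤ _ := by gcongr
  rcases lt_or_ge i 40 with c1 | c1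
  · have hx40 : x ≤ 2 / 5 := by
      have : ((i + 1 : ℕ) : ℝ) ≤ 40 := by exact_mod_cast c1
      linarith
    have hb : cellBound j i = (335 * 1000000000 * (4000 * (i + 1) ^ 2 + 75 * (i + 1) ^ 3)
        / (153600000 * (j * j)) + 1) * expNegBound (p * (10000 - q)) (64000000 * q) := by
      simp only [cellBound, if_pos c1, hp, hq]
    rw [smoothingRemainder, if_pos hx40, hb]
    have hC := div_le_div_add_one (335 * 1000000000 * (4000 * (i + 1) ^ 2 + 75 * (i + 1) ^ 3))
      (153600000 * (j * j))
    calc _ ≤ 0.335 * (125 / 48 * (((i + 1 : ℕ) : ℝ) / 100) ^ 2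
          + 625 / 128 * (((i + 1 : ℕ) : ℝ) / 100) ^ 3) / ((j : ℝ) / 100) ^ 2 *
          ((expNegBound (p * (10000 - q)) (64000000 * q) : ℝ) / 1000000000) := by gcongr
      _ = ((335 * 1000000000 * (4000 * (i + 1) ^ 2 + 75 * (i + 1) ^ 3) : ℕ) : ℝ)
          / ((153600000 * (j * j) : ℕ) : ℝ)
          * expNegBound (p * (10000 - q)) (64000000 * q) / 10 ^ 16 := by
        push_cast
        field_simp
        ring
      _ ≤ _ := by
        rw [Nat.cast_mul (_ / _ + 1)]
        gcongr
  · have hx40 : ¬ x ≤ 2 / 5 := by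
      have : (40 : ℝ) ≤ i := by exact_mod_cast c1
      intro h; linarith
    have hipos : (0 : ℝ) < i := by positivity
    rcases lt_or_ge i 50 with c2 | c2
    · have hx50 : x ≤ 1 / 2 := by
        have : ((i + 1 : ℕ) : ℝ) ≤ 50 := by exact_mod_cast c2
        linarith
      have hb : cellBound j i = (335000000 / i + 1) * expNegBound (p * 10000) (64000000 * q) := by
        simp only [cellBound, if_neg (not_lt.2 c1), if_pos c2, hp, hq]
      rw [smoothingRemainder, if_neg hx40, if_pos hx50, hb]
      have hC := div_le_div_add_one 335000000 i
      calc _ ≤ 0.335 / ((i : ℝ) / 100) *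
            ((expNegBound (p * 10000) (64000000 * q) : ℝ) / 1000000000) := by gcongr
        _ = ((335000000 : ℕ) : ℝ) / i * expNegBound (p * 10000) (64000000 * q) / 10 ^ 16 := by
          push_cast
          field_simp
          ring
        _ ≤ _ := by
          rw [Nat.cast_mul]
          gcongr
    · have hx50 : ¬ x ≤ 1 / 2 := by
        have : (50 : ℝ) ≤ i := by exact_mod_cast c2
        intro h; linarith
      have hb : cellBound j i = 128000 * (100 - i) * expNegBound (p * 10000) (64000000 * q) := by
        simp only [cellBound, if_neg (not_lt.2 c1), if_neg (not_lt.2 c2), hp, hq]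
      rw [smoothingRemainder, if_neg hx40, if_neg hx50, hb]
      have : 0 ≤ 1 - (i : ℝ) / 100 := by linarith
      calc _ ≤ 1.28 * (1 - (i : ℝ) / 100) *
            ((expNegBound (p * 10000) (64000000 * q) : ℝ) / 1000000000) := by gcongr
        _ = _ := by
          push_cast [Nat.cast_sub hi.le]
          ring

lemma integral_smoothingRemainder_le_of_fifth_le {ε : ℝ} (h1 : 1 / 5 ≤ ε) (h2 : ε < 0.71) :
    ∫ x in (0 : ℝ)..1, smoothingRemainder ε x ≤ 0.2686 * ε := by
  have hε0 : 0 < ε := by linarith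
  obtain ⟨j, hj, hj'⟩ : ∃ j : ℕ, (j : ℝ) / 100 ≤ ε ∧ ε < ((j + 1 : ℕ) : ℝ) / 100 := by
    refine ⟨⌊100 * ε⌋₊, ?_, ?_⟩
    · have := Nat.floor_le (by positivity : 0 ≤ 100 * ε)
      linarith
    · have := Nat.lt_floor_add_one (100 * ε)
      push_cast
      linarith
  have hj20 : 20 ≤ j := by
    have : (20 : ℝ) < ((j + 1 : ℕ) : ℝ) := by linarith
    have : 20 < j + 1 := by exact_mod_cast this
    omega
  have hj71 : j < 71 := by
    have : (j : ℝ) < 71 := by linarith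
    exact_mod_cast this
  have hi := intervalIntegrable_smoothingRemainder (ε := ε) (by nlinarith)
  have hi' : ∀ k : ℕ, k < 100 → IntervalIntegrable (smoothingRemainder ε) volume
      ((k : ℝ) / 100) (((k + 1 : ℕ) : ℝ) / 100) := by
    intro k hk
    refine hi.mono_set ?_
    rw [uIcc_of_le (by gcongr; omega), uIcc_of_le zero_le_one]
    refine Icc_subset_Icc (by positivity) ?_
    rw [div_le_one (by norm_num)]
    exact_mod_cast hk
  have hsum := intervalIntegral.sum_integral_adjacent_intervals (μ := volume)
    (f := smoothingRemainder ε) (a := fun k : ℕ => (k : ℝ) / 100) hi'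
  simp only [Nat.cast_zero, zero_div] at hsum
  have e100 : ((100 : ℕ) : ℝ) / 100 = 1 := by norm_num
  rw [e100] at hsum
  rw [← hsum]
  have hcell : ∀ k ∈ Finset.range 100,
      ∫ x in (k : ℝ) / 100..((k + 1 : ℕ) : ℝ) / 100, smoothingRemainder ε x
        ≤ (cellBound j k : ℝ) / 10 ^ 18 := by
    intro k hk
    have hk' := Finset.mem_range.1 hk
    have hle : (k : ℝ) / 100 ≤ ((k + 1 : ℕ) : ℝ) / 100 := by gcongr; omega
    calc _ ≤ ∫ _ in (k : ℝ) / 100..((k + 1 : ℕ) : ℝ) / 100, (cellBound j k : ℝ) / 10 ^ 16 :=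
          intervalIntegral.integral_mono_on_of_le_Ioo hle (hi' k hk') (by simp) fun x hx =>
            smoothingRemainder_le_cellBound (by omega) (by omega) hj hj'.le hk' hx.1 hx.2
      _ = _ := by
        rw [intervalIntegral.integral_const, smul_eq_mul]
        push_cast
        ring
  have hc := cellSum_le (j - 20) (by omega)
  rw [Nat.sub_add_cancel hj20, cellSum_eq] at hc
  have hc' : ((∑ i ∈ Finset.range 100, cellBound j i : ℕ) : ℝ) ≤ 2686000000000000 * j := by
    exact_mod_cast hc
  calc _ ≤ ∑ k ∈ Finset.range 100, (cellBound j k : ℝ) / 10 ^ 18 := Finset.sum_le_sum hcell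
    _ = ((∑ i ∈ Finset.range 100, cellBound j i : ℕ) : ℝ) / 10 ^ 18 := by
      rw [← Finset.sum_div]; push_cast; rfl
    _ ≤ 2686000000000000 * j / 10 ^ 18 := by gcongr
    _ ≤ 0.2686 * ε := by linarith

lemma integral_cubic_mul_exp_neg_sq_le {α γ b c : ℝ} (hα : 0 ≤ α) (hγ : 0 ≤ γ) (hb : 0 < b) :
    ∫ x in (0 : ℝ)..c, (α * x ^ 3 + γ * x) * exp (-(b * x ^ 2))
      ≤ α / (2 * b ^ 2) + γ / (2 * b) := by
  have h : ∀ x ∈ uIcc (0 : ℝ) c, HasDerivAt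
      (fun x => -((α * (x ^ 2 / (2 * b) + 1 / (2 * b ^ 2)) + γ / (2 * b)) * exp (-(b * x ^ 2))))
      ((α * x ^ 3 + γ * x) * exp (-(b * x ^ 2))) x := by
    intro x _
    have h1 : HasDerivAt (fun x : ℝ => x ^ 2) (2 * x) x := by simpa using hasDerivAt_pow 2 x
    have h2 : HasDerivAt (fun x : ℝ => -(b * x ^ 2)) (-(b * (2 * x))) x := (h1.const_mul b).neg
    convert! ((((h1.div_const (2 * b)).add_const (1 / (2 * b ^ 2))).const_mul α).add_const
      (γ / (2 * b))).mul h2.exp |>.neg using 1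
    field_simp
    ring
  rw [intervalIntegral.integral_eq_sub_of_hasDerivAt h
    (Continuous.intervalIntegrable (by fun_prop) _ _)]
  have : 0 ≤ (α * (c ^ 2 / (2 * b) + 1 / (2 * b ^ 2)) + γ / (2 * b)) * exp (-(b * c ^ 2)) := by
    positivity
  simp
  field_simp at this ⊢
  linarith

lemma integral_one_sub_mul_exp_neg_le {c : ℝ} (hc : 0 < c) :
    ∫ x in (1 / 2 : ℝ)..1, (1 - x) * exp (-(c * (1 - x))) ≤ 1 / c ^ 2 := by
  have h : ∀ x ∈ uIcc (1 / 2 : ℝ) 1, HasDerivAt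
      (fun x => ((1 - x) / c + 1 / c ^ 2) * exp (-(c * (1 - x))))
      ((1 - x) * exp (-(c * (1 - x)))) x := by
    intro x _
    have h1 : HasDerivAt (fun x : ℝ => 1 - x) (-1) x := by
      simpa using (hasDerivAt_id x).const_sub 1
    have h2 : HasDerivAt (fun x : ℝ => -(c * (1 - x))) (-(c * -1)) x := (h1.const_mul c).neg
    convert! ((h1.div_const c).add_const (1 / c ^ 2)).mul h2.exp using 1
    field_simp
    ring
  rw [intervalIntegral.integral_eq_sub_of_hasDerivAt h
    (Continuous.intervalIntegrable (by fun_prop) _ _)]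
  have : 0 ≤ ((1 - 1 / 2) / c + 1 / c ^ 2) * exp (-(c * (1 - 1 / 2))) := by
    norm_num
    positivity
  simp only [sub_self, mul_zero, neg_zero, exp_zero, zero_div]
  linarith

/-- Near 0 the integrand is compared with a Gaussian integral; the two remaining pieces are of
higher order in ε. The pieces total 0.2585 ε. -/
lemma integral_smoothingRemainder_le_of_le_fifth {ε : ℝ} (h0 : 0 < ε) (h1 : ε ≤ 1 / 5) :
    ∫ x in (0 : ℝ)..1, smoothingRemainder ε x ≤ 0.2686 * ε := by
  have hi := intervalIntegrable_smoothingRemainder (ε := ε) (by nlinarith)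
  have hsub : ∀ a b : ℝ, 0 ≤ a → a ≤ b → b ≤ 1 →
      IntervalIntegrable (smoothingRemainder ε) volume a b := fun a b ha hab hb => by
    refine hi.mono_set ?_
    rw [uIcc_of_le hab, uIcc_of_le zero_le_one]
    exact Icc_subset_Icc ha hb
  have i1 := hsub 0 (2 / 5) le_rfl (by norm_num) (by norm_num)
  have i2 := hsub (2 / 5) (1 / 2) (by norm_num) (by norm_num) (by norm_num)
  have i3 := hsub (1 / 2) 1 (by norm_num) (by norm_num) (by norm_num)
  have hε2 : 0 < ε ^ 2 := by positivity
  have hε2' : ε ^ 2 ≤ 1 / 25 := by nlinarith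
  have b1 : ∫ x in (0 : ℝ)..2 / 5, smoothingRemainder ε x ≤ 0.2312 * ε := by
    -- 9/5 = 0.96 · 0.6 · 25/8, from 1 - ε² ≥ 0.96 and 1 - x ≥ 0.6.
    set b : ℝ := 9 / (5 * ε ^ 2) with hb
    set α : ℝ := 0.335 * (125 / 72 / ε + 625 / 128) / ε ^ 2 with hα
    set γ : ℝ := 0.335 * (125 / 128) / ε with hγ
    calc _ ≤ ∫ x in (0 : ℝ)..2 / 5, (α * x ^ 3 + γ * x) * exp (-(b * x ^ 2)) := by
          refine intervalIntegral.integral_mono_on_of_le_Ioo (by norm_num) i1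
            (Continuous.intervalIntegrable (by fun_prop) _ _) fun x hx => ?_
          have hx0 : 0 < x := hx.1
          rw [smoothingRemainder, if_pos hx.2.le]
          have e1 : 0.335 * (125 / 48 * x ^ 2 + 625 / 128 * x ^ 3) / ε ^ 2 ≤ α * x ^ 3 + γ * x := by
            -- AM–GM with equality at x = 3ε/4, replacing x² by odd powers so that the Gaussian
            -- integral is elementary.
            have : x ^ 2 ≤ 2 / 3 * x ^ 3 / ε + 3 / 8 * ε * x := by
              have e : 2 / 3 * x ^ 3 / ε + 3 / 8 * ε * x - x ^ 2
                  = x / ε * (2 / 3) * (x - 3 / 4 * ε) ^ 2 := by field_simp; ring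
              have : 0 ≤ x / ε * (2 / 3) * (x - 3 / 4 * ε) ^ 2 := by positivity
              linarith
            have e : α * x ^ 3 + γ * x = 0.335 * (125 / 48 * (2 / 3 * x ^ 3 / ε + 3 / 8 * ε * x)
                + 625 / 128 * x ^ 3) / ε ^ 2 := by
              rw [hα, hγ]; field_simp; ring
            rw [e]
            gcongr
          have e2 : b * x ^ 2 ≤ (1 - ε ^ 2) * (25 / 8 * x ^ 2 * (1 - x)) / ε ^ 2 := by
            rw [hb, le_div_iff₀ hε2]
            have a1 : (0.96 : ℝ) ≤ 1 - ε ^ 2 := by linarith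
            have a2 : (0.6 : ℝ) ≤ 1 - x := by linarith [hx.2]
            calc 9 / (5 * ε ^ 2) * x ^ 2 * ε ^ 2 = 0.96 * (25 / 8 * x ^ 2 * 0.6) := by
                  field_simp; norm_num
              _ ≤ _ := by gcongr
          have hα0 : 0 ≤ α := by positivity
          have hγ0 : 0 ≤ γ := by positivity
          gcongr
      _ ≤ α / (2 * b ^ 2) + γ / (2 * b) :=
          integral_cubic_mul_exp_neg_sq_le (by positivity) (by positivity) (by positivity)
      _ = 0.335 * (125 / 72 * (25 / 162) + 625 / 128 * (25 / 162) * ε + 125 / 128 * (5 / 18)) * ε := by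
          rw [hα, hγ, hb]; field_simp; ring
      _ ≤ _ := by gcongr; linarith
  have b2 : ∫ x in (2 / 5 : ℝ)..1 / 2, smoothingRemainder ε x ≤ 0.0104 * ε := by
    have hE : exp (-(25 / 100 / ε ^ 2)) ≤ 0.123 * ε := by
      set u : ℝ := 25 / 100 / ε ^ 2 with hu
      have hu0 : 0 < u := by positivity
      have h4 := Real.sum_le_exp_of_nonneg hu0.le 4
      simp only [Finset.sum_range_succ, Finset.sum_range_zero, Nat.factorial] at h4
      have h5 : u ^ 3 / 6 ≤ exp u := by
        refine le_trans ?_ h4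
        push_cast
        have : 0 ≤ u ^ 2 := by positivity
        norm_num
        linarith
      rw [exp_neg]
      calc (exp u)⁻¹ ≤ (u ^ 3 / 6)⁻¹ := by gcongr
        _ = 384 * ε ^ 5 * ε := by rw [hu]; field_simp; norm_num
        _ ≤ 384 * (1 / 5) ^ 5 * ε := by gcongr
        _ ≤ _ := by gcongr; norm_num
    calc _ ≤ ∫ _ in (2 / 5 : ℝ)..1 / 2, 0.335 / (2 / 5) * (0.123 * ε) := by
          refine intervalIntegral.integral_mono_on_of_le_Ioo (by norm_num) i2 (by simp)
            fun x hx => ?_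
          rw [smoothingRemainder, if_neg (not_le.2 hx.1), if_pos hx.2.le]
          have hx' := hx.1
          have : 25 / 100 / ε ^ 2 ≤ 25 / 8 * x ^ 2 * (1 - x) / ε ^ 2 := by
            gcongr
            have a2 : (1 / 2 : ℝ) ≤ 1 - x := by linarith [hx.2]
            calc (25 / 100 : ℝ) = 25 / 8 * (2 / 5) ^ 2 * (1 / 2) := by norm_num
              _ ≤ _ := by gcongr
          have h3 : exp (-(25 / 8 * x ^ 2 * (1 - x) / ε ^ 2)) ≤ 0.123 * ε :=
            le_trans (by gcongr) hE
          gcongr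
      _ ≤ _ := by
          rw [intervalIntegral.integral_const, smul_eq_mul]
          linarith
  have b3 : ∫ x in (1 / 2 : ℝ)..1, smoothingRemainder ε x ≤ 0.0169 * ε := by
    set c : ℝ := 25 / 32 / ε ^ 2 with hc
    calc _ ≤ ∫ x in (1 / 2 : ℝ)..1, 1.28 * ((1 - x) * exp (-(c * (1 - x)))) := by
          refine intervalIntegral.integral_mono_on_of_le_Ioo (by norm_num) i3
            (Continuous.intervalIntegrable (by fun_prop) _ _) fun x hx => ?_
          have hx1 := hx.1
          have hx2 : 0 ≤ 1 - x := by linarith [hx.2]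
          rw [smoothingRemainder, if_neg (by linarith), if_neg (by linarith), ← mul_assoc]
          gcongr
          rw [hc, div_mul_eq_mul_div]
          gcongr
          calc (25 / 32 : ℝ) = 25 / 8 * (1 / 2) ^ 2 := by norm_num
            _ ≤ _ := by gcongr
      _ ≤ 1.28 * (1 / c ^ 2) := by
          rw [intervalIntegral.integral_const_mul]
          gcongr
          exact integral_one_sub_mul_exp_neg_le (by positivity)
      _ = 1.28 * 1024 / 625 * ε ^ 3 * ε := by rw [hc]; field_simp; norm_num
      _ ≤ 1.28 * 1024 / 625 * (1 / 5) ^ 3 * ε := by gcongr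
      _ ≤ _ := by gcongr; norm_num
  rw [← intervalIntegral.integral_add_adjacent_intervals (i1.trans i2) i3,
    ← intervalIntegral.integral_add_adjacent_intervals i1 i2]
  linarith

theorem integral_smoothingRemainder_le {ε : ℝ} (h0 : 0 < ε) (h1 : ε < 0.71) :
    ∫ x in (0 : ℝ)..1, smoothingRemainder ε x ≤ 0.2686 * ε := by
  rcases le_total ε (1 / 5) with h | h
  · exact integral_smoothingRemainder_le_of_le_fifth h0 h
  · exact integral_smoothingRemainder_le_of_fifth_le h h1

/-! ### The one-sided Berry–Esseen bound -/

section OneSided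

variable {ν : Measure ℝ}

lemma norm_shiftedCharFun (T z x : ℝ) : ‖shiftedCharFun ν T z x‖ = ‖charFun ν (T * x)‖ := by
  rw [shiftedCharFun, norm_mul, Complex.norm_exp_ofReal_mul_I, one_mul, charFun_neg,
    Complex.norm_conj]

lemma norm_shiftedCharFun_sub (T z x : ℝ) :
    ‖shiftedCharFun ν T z x
      - Complex.exp ((z * (T * x) : ℝ) * Complex.I) * (exp (-((T * x) ^ 2 / 2)) : ℝ)‖
      = ‖charFun ν (T * x) - Complex.exp (-((T * x : ℝ) ^ 2 / 2))‖ := by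
  rw [shiftedCharFun, ← mul_sub, norm_mul, Complex.norm_exp_ofReal_mul_I, one_mul, charFun_neg,
    ← Complex.norm_conj, map_sub, Complex.conj_conj, Complex.conj_ofReal]
  push_cast
  rfl

/-- For x ≤ 2/5 the Gaussian part `W₀` is split off: W - W₀ meets the full weight, while `W₀` meets
the weight with 1/(πx) removed and costs at most g. For larger x the decay of W alone is used, and
the inversion term costs at most g since πx > 1. The cutoff 5/(2ε) makes 0.4 ε t equal to x. -/
lemma smoothing_integrand_le {ε z x : ℝ} (hε : 0 < ε) (hx0 : 0 < x) (hx1 : x < 1)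
    (hF : ∀ t, 0 ≤ t → ‖charFun ν t‖ ≤ exp (-(t ^ 2 / 2 * (1 - 0.4 * ε * t))))
    (hD : ∀ t, 0 ≤ t → 0.4 * ε * t ≤ 1 → ‖charFun ν t - Complex.exp (-(t ^ 2 / 2))‖ ≤
      (ε * t ^ 3 / 6 + ε ^ 2 * t ^ 4 / 8) * exp (-((1 - ε ^ 2) * (t ^ 2 / 2 * (1 - 0.4 * ε * t))))) :
    (1 - x) * (shiftedCharFun ν (5 / (2 * ε)) z x).re
      + sineWeight x * (shiftedCharFun ν (5 / (2 * ε)) z x).im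
      - 1 / (π * x) * (sin (z * (5 / (2 * ε) * x)) * exp (-((5 / (2 * ε) * x) ^ 2 / 2)))
        ≤ exp (-((5 / (2 * ε) * x) ^ 2 / 2)) + smoothingRemainder ε x := by
  set T := 5 / (2 * ε) with hT
  set g := exp (-((T * x) ^ 2 / 2)) with hg
  set W := shiftedCharFun ν T z x with hW
  set W₀ : ℂ := Complex.exp ((z * (T * x) : ℝ) * Complex.I) * (g : ℝ) with hW0
  have hg0 : 0 < g := exp_pos _
  have hTx : 0 ≤ T * x := by positivity
  have e1 : 0.4 * ε * (T * x) = x := by rw [hT]; field_simp; norm_num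
  have e2 : (T * x) ^ 2 / 2 * (1 - 0.4 * ε * (T * x)) = 25 / 8 * x ^ 2 * (1 - x) / ε ^ 2 := by
    rw [e1, hT]; field_simp; ring
  have hF' : ‖W‖ ≤ exp (-(25 / 8 * x ^ 2 * (1 - x) / ε ^ 2)) := by
    rw [hW, norm_shiftedCharFun, ← e2]
    exact hF _ hTx
  rcases le_or_gt x (2 / 5) with hx | hx
  · have hD' : ‖W - W₀‖ ≤ (125 / 48 * x ^ 3 + 625 / 128 * x ^ 4) / ε ^ 2
        * exp (-((1 - ε ^ 2) * (25 / 8 * x ^ 2 * (1 - x)) / ε ^ 2)) := by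
      rw [hW, hW0, hg, norm_shiftedCharFun_sub]
      refine (hD _ hTx (by rw [e1]; exact hx1.le)).trans (le_of_eq ?_)
      rw [e2, ← mul_div_assoc (1 - ε ^ 2), hT]
      congr 1
      field_simp
      ring
    have hre : W₀.re = cos (z * (T * x)) * g := by
      rw [hW0, Complex.mul_re, Complex.exp_ofReal_mul_I_re, Complex.ofReal_re, Complex.ofReal_im]
      ring
    have him : W₀.im = sin (z * (T * x)) * g := by
      rw [hW0, Complex.mul_im, Complex.exp_ofReal_mul_I_im, Complex.ofReal_re, Complex.ofReal_im]
      ring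
    have hn : ‖W₀‖ ≤ g := by
      rw [hW0, norm_mul, Complex.norm_exp_ofReal_mul_I, one_mul, Complex.norm_real,
        norm_of_nonneg hg0.le]
    have a1 := re_im_le (a := 1 - x) (b := sineWeight x) (k := 0.335 / x) (by positivity)
      (sq_add_sineWeight_sq_le_of_le_half hx0 (by linarith)) hD'
    have a2 := re_im_le (a := 1 - x) (b := sineWeight x - 1 / (π * x)) (k := 1) zero_le_one
      (by rw [one_pow]; exact sq_add_sineWeight_sub_sq_le_one hx0 (by linarith)) hn
    rw [smoothingRemainder, if_pos hx]
    have e3 : 0.335 / x * ((125 / 48 * x ^ 3 + 625 / 128 * x ^ 4) / ε ^ 2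
        * exp (-((1 - ε ^ 2) * (25 / 8 * x ^ 2 * (1 - x)) / ε ^ 2)))
        = 0.335 * (125 / 48 * x ^ 2 + 625 / 128 * x ^ 3) / ε ^ 2
          * exp (-((1 - ε ^ 2) * (25 / 8 * x ^ 2 * (1 - x)) / ε ^ 2)) := by
      field_simp
    rw [e3, Complex.sub_re, Complex.sub_im] at a1
    rw [one_mul, him] at a2
    rw [him] at a1
    linarith
  · have a0 : -(1 / (π * x) * (sin (z * (T * x)) * g)) ≤ g := by
      have h1 : 1 / (π * x) ≤ 1 := by
        rw [div_le_one (by positivity)]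
        nlinarith [pi_gt_d2]
      have h0 : 0 < 1 / (π * x) := by positivity
      have h2 := neg_one_le_sin (z * (T * x))
      have h3 : 1 / (π * x) * -sin (z * (T * x)) ≤ 1 := by nlinarith
      nlinarith
    rcases le_or_gt x (1 / 2) with hx' | hx'
    · have a1 := re_im_le (a := 1 - x) (b := sineWeight x) (k := 0.335 / x) (by positivity)
        (sq_add_sineWeight_sq_le_of_le_half hx0 hx') hF'
      rw [smoothingRemainder, if_neg hx.not_ge, if_pos hx']
      linarith
    · have a1 := re_im_le (a := 1 - x) (b := sineWeight x) (k := 1.28 * (1 - x))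
        (mul_nonneg (by norm_num) (by linarith))
        (sq_add_sineWeight_sq_le_of_half_le hx'.le hx1) hF'
      rw [smoothingRemainder, if_neg hx.not_ge, if_neg hx'.not_ge]
      linarith

variable [IsProbabilityMeasure ν]

/-- The two costs are 0.5014 ε and 0.2686 ε, which add up to 0.77 ε. -/
lemma measureReal_Iic_le_of_small {ε : ℝ} (hε : 0 < ε) (hε1 : ε < 0.71)
    (hν : Integrable (fun x => x) ν)
    (hF : ∀ t, 0 ≤ t → ‖charFun ν t‖ ≤ exp (-(t ^ 2 / 2 * (1 - 0.4 * ε * t))))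
    (hD : ∀ t, 0 ≤ t → 0.4 * ε * t ≤ 1 → ‖charFun ν t - Complex.exp (-(t ^ 2 / 2))‖ ≤
      (ε * t ^ 3 / 6 + ε ^ 2 * t ^ 4 / 8) * exp (-((1 - ε ^ 2) * (t ^ 2 / 2 * (1 - 0.4 * ε * t)))))
    (z : ℝ) :
    ν.real (Iic z) ≤ stdNormalCDF z + 0.77 * ε := by
  have h1 := measureReal_Iic_le_stdNormalCDF_add (5 / (2 * ε)) z (by positivity) hν
    (intervalIntegrable_smoothingRemainder (by nlinarith))
    fun x hx0 hx1 => smoothing_integrand_le hε hx0 hx1 hF hD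
  have h2 := integral_smoothingRemainder_le hε hε1
  have h3 : √(π / 2) / (5 / (2 * ε)) ≤ 0.5014 * ε := by
    have : √(π / 2) ≤ 1.2535 := sqrt_le_iff.2 ⟨by norm_num, by nlinarith [pi_lt_d4]⟩
    rw [div_le_iff₀ (by positivity)]
    refine this.trans (le_of_eq ?_)
    field_simp
    norm_num
  linarith

/-- Cantelli's inequality for a standardized law. -/
lemma measureReal_Iic_neg_le (hi : Integrable (fun x => x ^ 2) ν) (hm : ∫ x, x ∂ν = 0)
    (hv : ∫ x, x ^ 2 ∂ν = 1) {a : ℝ} (ha : 0 ≤ a) : ν.real (Iic (-a)) ≤ 1 / (1 + a ^ 2) := by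
  have i1 := integrable_id_of_sq hi
  have hpos : 0 < 1 + a ^ 2 := by positivity
  have j1 : Integrable (fun x => 1 - 2 * a * x) ν := (integrable_const 1).sub (i1.const_mul _)
  have j2 : Integrable (fun x => 1 - 2 * a * x + a ^ 2 * x ^ 2) ν := j1.add (hi.const_mul _)
  have h : (1 + a ^ 2) ^ 2 * ν.real (Iic (-a)) ≤ 1 + a ^ 2 := by
    calc _ = ∫ x, (Iic (-a)).indicator (fun _ => (1 + a ^ 2) ^ 2) x ∂ν := by
          rw [integral_indicator_const _ measurableSet_Iic, smul_eq_mul, mul_comm]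
      _ ≤ ∫ x, (1 - 2 * a * x + a ^ 2 * x ^ 2) ∂ν := by
          refine integral_mono ((integrable_const _).indicator measurableSet_Iic) j2 fun x => ?_
          have e : 1 - 2 * a * x + a ^ 2 * x ^ 2 = (1 - a * x) ^ 2 := by ring
          simp only [e]
          by_cases hx : x ∈ Iic (-a)
          · rw [indicator_of_mem hx]
            have hx' : x ≤ -a := hx
            have : 1 + a ^ 2 ≤ 1 - a * x := by nlinarith
            gcongr
          · rw [indicator_of_notMem hx]
            positivity
      _ = 1 + a ^ 2 := by
          rw [integral_add j1 (hi.const_mul _), integral_sub (integrable_const 1)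
            (i1.const_mul _), integral_const_mul, integral_const_mul, hm, hv]
          simp
  rw [le_div_iff₀ hpos]
  nlinarith

/-- 0.5467 = 0.77 · 0.71. For z ≥ 0 the normal value is already at least 1/2; for z = -a Cantelli's
1/(1 + a²) is compared with 0 when a ≥ 1 and with 1/2 - 0.399 a when a ≤ 1. -/
lemma measureReal_Iic_le_of_large (hi : Integrable (fun x => x ^ 2) ν) (hm : ∫ x, x ∂ν = 0)
    (hv : ∫ x, x ^ 2 ∂ν = 1) (z : ℝ) : ν.real (Iic z) ≤ stdNormalCDF z + 0.5467 := by
  rcases le_total 0 z with hz | hz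
  · have := half_le_stdNormalCDF hz
    have : ν.real (Iic z) ≤ 1 := measureReal_le_one
    linarith
  · obtain ⟨a, rfl⟩ : ∃ a, z = -a := ⟨-z, (neg_neg z).symm⟩
    have ha : 0 ≤ a := by linarith
    refine (measureReal_Iic_neg_le hi hm hv ha).trans ?_
    rw [div_le_iff₀ (by positivity)]
    rcases le_total 1 a with h1 | h1
    · have := stdNormalCDF_nonneg (-a)
      nlinarith [mul_nonneg this (sq_nonneg a)]
    · have h2 := half_sub_le_stdNormalCDF_neg ha
      -- The margin is smallest near a = 0.21, hence the squares supplied.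
      have h3 : 1 ≤ (1 / 2 - 0.399 * a + 0.5467) * (1 + a ^ 2) := by
        nlinarith [mul_nonneg (sub_nonneg.2 h1) (sq_nonneg (a - 0.21)), sq_nonneg (a - 0.21)]
      refine h3.trans ?_
      gcongr

variable {ρ : Measure ℝ} [IsProbabilityMeasure ρ] {n : ℕ}

theorem measureReal_Iic_le_of_charFun_eq_pow (hn : 1 ≤ n)
    (hm : ∫ x, x ∂ρ = 0) (hv : ∫ x, x ^ 2 ∂ρ = 1) (h3 : Integrable (fun x => |x| ^ 3) ρ)
    (hνi : Integrable (fun x => x ^ 2) ν) (hνm : ∫ x, x ∂ν = 0) (hνv : ∫ x, x ^ 2 ∂ν = 1)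
    (hc : ∀ t, charFun ν t = charFun ρ (t / √n) ^ n) (z : ℝ) :
    ν.real (Iic z) ≤ stdNormalCDF z + 0.77 * ((∫ x, |x| ^ 3 ∂ρ) / √n) := by
  have hs : 0 < √(n : ℝ) := by positivity
  have hβ := one_le_integral_abs_pow_three hv h3
  have hε : (∫ x, |x| ^ 3 ∂ρ) = (∫ x, |x| ^ 3 ∂ρ) / √n * √n := by field_simp
  rcases lt_or_ge ((∫ x, |x| ^ 3 ∂ρ) / √n) 0.71 with h | h
  · refine measureReal_Iic_le_of_small (by positivity) h (integrable_id_of_sq hνi)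
      (fun t ht => ?_) (fun t ht ht' => ?_) z
    · rw [hc]
      exact norm_charFun_pow_le hm hv h3 hn hε ht
    · rw [hc]
      exact norm_charFun_pow_sub_le hm hv h3 hn hε ht ht'
  · have := measureReal_Iic_le_of_large hνi hνm hνv z
    linarith

theorem abs_measureReal_Iic_sub_le (hn : 1 ≤ n)
    (hm : ∫ x, x ∂ρ = 0) (hv : ∫ x, x ^ 2 ∂ρ = 1) (h3 : Integrable (fun x => |x| ^ 3) ρ)
    (hνi : Integrable (fun x => x ^ 2) ν) (hνm : ∫ x, x ∂ν = 0) (hνv : ∫ x, x ^ 2 ∂ν = 1)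
    (hc : ∀ t, charFun ν t = charFun ρ (t / √n) ^ n) (z : ℝ) :
    |ν.real (Iic z) - stdNormalCDF z| ≤ 0.77 * ((∫ x, |x| ^ 3 ∂ρ) / √n) := by
  have hmeas : Measurable fun x : ℝ => -1 * x := by fun_prop
  have hmap (κ : Measure ℝ) (f : ℝ → ℝ) (hf : Continuous f) :
      ∫ x, f x ∂(κ.map fun x => -1 * x) = ∫ x, f (-1 * x) ∂κ :=
    integral_map hmeas.aemeasurable hf.aestronglyMeasurable
  have hmapi (κ : Measure ℝ) (f : ℝ → ℝ) (hf : Continuous f) :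
      Integrable f (κ.map fun x => -1 * x) ↔ Integrable (fun x => f (-1 * x)) κ :=
    integrable_map_measure hf.aestronglyMeasurable hmeas.aemeasurable
  have : IsProbabilityMeasure (ρ.map fun x => -1 * x) :=
    Measure.isProbabilityMeasure_map hmeas.aemeasurable
  have : IsProbabilityMeasure (ν.map fun x => -1 * x) :=
    Measure.isProbabilityMeasure_map hmeas.aemeasurable
  have eβ : ∫ x, |x| ^ 3 ∂(ρ.map fun x => -1 * x) = ∫ x, |x| ^ 3 ∂ρ := by
    rw [hmap _ _ (by fun_prop)]; simp
  have h1 := measureReal_Iic_le_of_charFun_eq_pow hn hm hv h3 hνi hνm hνv hc z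
  -- The reflected laws satisfy the same hypotheses; the bound at -z concerns the event S ≥ z, which
  -- contains the complement of S ≤ z.
  have h2 := measureReal_Iic_le_of_charFun_eq_pow (ν := ν.map fun x => -1 * x)
    (ρ := ρ.map fun x => -1 * x) hn
    (by rw [hmap _ _ (by fun_prop), integral_const_mul, hm, mul_zero])
    (by rw [hmap _ _ (by fun_prop)]; simpa using hv)
    (by rw [hmapi _ _ (by fun_prop)]; simpa using h3)
    (by rw [hmapi _ _ (by fun_prop)]; simpa using hνi)
    (by rw [hmap _ _ (by fun_prop), integral_const_mul, hνm, mul_zero])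
    (by rw [hmap _ _ (by fun_prop)]; simpa using hνv)
    (fun t => by rw [charFun_map_mul, charFun_map_mul, hc, mul_div_assoc]) (-z)
  rw [eβ, stdNormalCDF_neg, map_measureReal_apply hmeas measurableSet_Iic] at h2
  have e : (fun x : ℝ => -1 * x) ⁻¹' Iic (-z) = Ici z := by ext x; simp
  rw [e] at h2
  have h4 : 1 - ν.real (Iic z) ≤ ν.real (Ici z) := by
    rw [← probReal_compl_eq_one_sub measurableSet_Iic, compl_Iic]
    exact measureReal_mono Ioi_subset_Ici_self
  rw [abs_le]
  constructor <;> linarith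

end OneSided

/-! ### Standardized sample means -/

section SampleMean

variable {Ω : Type*} [MeasurableSpace Ω] {P : Measure Ω}
  {X : ℕ → Ω → ℝ}

lemma integral_sampleMean {m : ℝ} (hi : ∀ i, Integrable (X i) P) (hm : ∀ i, ∫ ω, X i ω ∂P = m)
    {n : ℕ} (hn : 1 ≤ n) : ∫ ω, sampleMean X n ω ∂P = m := by
  have : (n : ℝ) ≠ 0 := by positivity
  simp only [sampleMean]
  rw [integral_div, integral_finsetSum _ fun i _ => hi i]
  simp only [hm, Finset.sum_const, Finset.card_range, nsmul_eq_mul]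
  field_simp

lemma variance_sampleMean {v : ℝ} (hindep : iIndepFun X P) (hX : ∀ i, MemLp (X i) 2 P)
    (hv : ∀ i, variance (X i) P = v) {n : ℕ} (hn : 1 ≤ n) :
    variance (sampleMean X n) P = v / n := by
  have h0 : (n : ℝ) ≠ 0 := by positivity
  have e : sampleMean X n = fun ω => (n : ℝ)⁻¹ * (∑ i ∈ Finset.range n, X i) ω := by
    ext ω
    simp [sampleMean, div_eq_inv_mul]
  rw [e, variance_const_mul, IndepFun.variance_sum (fun i _ => hX i)
    (fun i _ j _ hij => hindep.indepFun hij)]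
  simp only [hv, Finset.sum_const, Finset.card_range, nsmul_eq_mul]
  field_simp

lemma standardizedSampleMean_eq [IsProbabilityMeasure P] {m v : ℝ} (hindep : iIndepFun X P)
    (hX : ∀ i, MemLp (X i) 2 P)
    (hm : ∀ i, ∫ ω, X i ω ∂P = m) (hv : ∀ i, variance (X i) P = v) (hv0 : 0 < v)
    {n : ℕ} (hn : 1 ≤ n) (ω : Ω) :
    standardizedSampleMean P X n ω
      = ((∑ i ∈ Finset.range n, X i ω) - n * m) / √(n * v) := by
  have h0 : (0 : ℝ) < n := by positivity
  rw [standardizedSampleMean, integral_sampleMean (fun i => (hX i).integrable one_le_two) hm hn,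
    variance_sampleMean hindep hX hv hn, sampleMean]
  have e : √(n * v) = n * √(v / n) := by
    rw [show (n : ℝ) * v = n ^ 2 * (v / n) by field_simp, sqrt_mul (by positivity),
      sqrt_sq h0.le]
  have : √(v / n) ≠ 0 := by positivity
  rw [e]
  field_simp

lemma standardizedSampleMean_eq_sum [IsProbabilityMeasure P] {m v : ℝ} (hindep : iIndepFun X P)
    (hX : ∀ i, MemLp (X i) 2 P) (hm : ∀ i, ∫ ω, X i ω ∂P = m)
    (hv : ∀ i, variance (X i) P = v) (hv0 : 0 < v) (n : ℕ) (ω : Ω) :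
    standardizedSampleMean P X n ω
      = (√n)⁻¹ * ∑ i ∈ Finset.range n, (X i ω - m) / √v := by
  -- For n = 0 both sides are 0 by the convention for division by zero, so the identity holds for
  -- the whole sequence and can be rewritten inside a limit.
  rcases Nat.eq_zero_or_pos n with rfl | hn
  · simp [standardizedSampleMean, sampleMean]
  · have h0 : (0 : ℝ) < n := by positivity
    rw [standardizedSampleMean_eq hindep hX hm hv hv0 hn, ← Finset.sum_div,
      Finset.sum_sub_distrib, sqrt_mul h0.le]
    simp only [Finset.sum_const, Finset.card_range, nsmul_eq_mul]
    field_simp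

lemma tendsto_measureReal_le_of_tendstoInDistribution [IsProbabilityMeasure P] {Ω' : Type*}
    [MeasurableSpace Ω'] {P' : Measure Ω'} [IsProbabilityMeasure P'] {S : ℕ → Ω → ℝ} {Z : Ω' → ℝ}
    (h : TendstoInDistribution S atTop Z (fun _ => P) P') {z : ℝ} (hz : P'.map Z {z} = 0) :
    Tendsto (fun n => P.real {ω | S n ω ≤ z}) atTop (𝓝 (P'.real {ω | Z ω ≤ z})) := by
  have h1 := ProbabilityMeasure.tendsto_measure_of_null_frontier_of_tendsto' h.tendsto
    (E := Iic z) (by rw [frontier_Iic]; exact hz)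
  have h2 := (ENNReal.tendsto_toReal (measure_ne_top (P'.map Z) (Iic z))).comp h1
  have e : (P'.map Z (Iic z)).toReal = P'.real {ω | Z ω ≤ z} := by
    rw [Measure.map_apply_of_aemeasurable h.aemeasurable_limit measurableSet_Iic]
    rfl
  rw [← e]
  refine h2.congr fun n => ?_
  change ((P.map (S n)) (Iic z)).toReal = _
  rw [Measure.map_apply_of_aemeasurable (h.forall_aemeasurable n) measurableSet_Iic]
  rfl

lemma measureReal_le_of_hasLaw_gaussianReal {Z : Ω → ℝ} (hZ : HasLaw Z (gaussianReal 0 1) P)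
    (z : ℝ) : P.real {ω | Z ω ≤ z} = stdNormalCDF z := by
  rw [← gaussianReal_real_Iic, ← hZ.map_eq, measureReal_def, measureReal_def,
    Measure.map_apply_of_aemeasurable hZ.aemeasurable measurableSet_Iic]
  rfl

variable [IsProbabilityMeasure P]

/-- **Berry–Esseen** for normalized sums of standardized random variables. -/
theorem abs_measureReal_inv_sqrt_mul_sum_le {Y : ℕ → Ω → ℝ} (hindep : iIndepFun Y P)
    (hident : ∀ i, IdentDistrib (Y i) (Y 0) P P) (hY : MemLp (Y 0) 2 P)
    (h0 : ∫ ω, Y 0 ω ∂P = 0) (h1 : ∫ ω, Y 0 ω ^ 2 ∂P = 1)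
    (h3 : Integrable (fun ω => |Y 0 ω| ^ 3) P) {n : ℕ} (hn : 1 ≤ n) (z : ℝ) :
    |P.real {ω | (√n)⁻¹ * ∑ i ∈ Finset.range n, Y i ω ≤ z} - stdNormalCDF z|
      ≤ 0.77 * ((∫ ω, |Y 0 ω| ^ 3 ∂P) / √n) := by
  have hn0 : (0 : ℝ) < n := by positivity
  have hL : ∀ i, MemLp (Y i) 2 P := fun i => (hident i).memLp_iff.2 hY
  have hmY : AEMeasurable (Y 0) P := (hident 0).aemeasurable_fst
  set S : Ω → ℝ := fun ω => (√n)⁻¹ * ∑ i ∈ Finset.range n, Y i ω with hS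
  have hSL : MemLp S 2 P := (memLp_finsetSum _ fun i _ => hL i).const_mul _
  have hmS : AEMeasurable S P := hSL.aestronglyMeasurable.aemeasurable
  have hS0 : ∫ ω, S ω ∂P = 0 := by
    rw [hS, integral_const_mul, integral_finsetSum _ fun i _ => (hL i).integrable one_le_two]
    simp [fun i => (hident i).integral_eq, h0]
  have hvar : variance S P = 1 := by
    have e : S = fun ω => (√n)⁻¹ * (∑ i ∈ Finset.range n, Y i) ω := by
      ext ω
      simp [hS]
    have hv : variance (Y 0) P = 1 := by
      rw [variance_of_integral_eq_zero hmY h0, ← h1]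
    rw [e, variance_const_mul, IndepFun.variance_sum (fun i _ => hL i)
      (fun i _ j _ hij => hindep.indepFun hij)]
    simp only [fun i => (hident i).variance_eq, hv, Finset.sum_const, Finset.card_range,
      nsmul_eq_mul, inv_pow, sq_sqrt hn0.le]
    field_simp
  have : IsProbabilityMeasure (P.map (Y 0)) := Measure.isProbabilityMeasure_map hmY
  have : IsProbabilityMeasure (P.map S) := Measure.isProbabilityMeasure_map hmS
  have main := abs_measureReal_Iic_sub_le (ν := P.map S) (ρ := P.map (Y 0)) hn
    (by rw [integral_map hmY (by fun_prop), h0])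
    (by rw [integral_map hmY (by fun_prop), h1])
    ((integrable_map_measure (by fun_prop) hmY).2 h3)
    ((integrable_map_measure (by fun_prop) hmS).2 hSL.integrable_sq)
    (by rw [integral_map hmS (by fun_prop), hS0])
    (by rw [integral_map hmS (by fun_prop), ← variance_of_integral_eq_zero hmS hS0, hvar])
    (fun t => by rw [hS, charFun_inv_sqrt_mul_sum hindep hident, div_eq_inv_mul]) z
  rw [integral_map hmY (by fun_prop), measureReal_def,
    Measure.map_apply_of_aemeasurable hmS measurableSet_Iic] at main
  exact main

end SampleMean

end BerryEsseen

/-- The central limit theorem with the Berry-Esseen bound. `X 0, X 1, …` are independent copies of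
`X'`, and `Z` is any standard normal random variable. -/
theorem mainTheorem1
    {Ω Ω' Ω'' : Type*} [MeasurableSpace Ω] [MeasurableSpace Ω'] [MeasurableSpace Ω'']
    (P : Measure Ω) [IsProbabilityMeasure P]
    (P' : Measure Ω') [IsProbabilityMeasure P']
    (P'' : Measure Ω'') [IsProbabilityMeasure P'']
    (X' : Ω' → ℝ) (X : ℕ → Ω → ℝ) (Z : Ω'' → ℝ) (μ σ : ℝ)
    (hindep : iIndepFun X P)
    (hident : ∀ i, IdentDistrib (X i) X' P P')
    (hfinite : MemLp X' 2 P')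
    (hmean : ∫ ω, X' ω ∂P' = μ)
    (hvar : variance X' P' = σ ^ 2)
    (hpos : 0 < σ ^ 2)
    (hZ : HasLaw Z (gaussianReal 0 1) P'') :
    (∀ n : ℕ, 1 ≤ n → ∀ ω : Ω,
      standardizedSampleMean P X n ω
        = ((∑ i ∈ Finset.range n, X i ω) - (n : ℝ) * μ) / √((n : ℝ) * σ ^ 2)) ∧
    (∀ z : ℝ,
      Tendsto (fun n : ℕ => P.real {ω | standardizedSampleMean P X n ω ≤ z}) atTop
        (𝓝 (P''.real {ω | Z ω ≤ z})) ∧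
      P''.real {ω | Z ω ≤ z} = stdNormalCDF z) ∧
    TendstoInDistribution (fun n : ℕ => standardizedSampleMean P X n) atTop Z
      (fun _ => P) P'' ∧
    (Integrable (fun ω => |X 0 ω - ∫ ω', X 0 ω' ∂P| ^ 3) P →
      ∀ n : ℕ, 1 ≤ n → ∀ z : ℝ,
        |P.real {ω | standardizedSampleMean P X n ω ≤ z} - stdNormalCDF z|
          ≤ (0.77 * ∫ ω, |X 0 ω - ∫ ω', X 0 ω' ∂P| ^ 3 ∂P)
              / ((variance (X 0) P) ^ (3 / 2 : ℝ) * √(n : ℝ))) := by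
  have hL : ∀ i, MemLp (X i) 2 P := fun i => (hident i).memLp_iff.2 hfinite
  have hm : ∀ i, ∫ ω, X i ω ∂P = μ := fun i => by rw [(hident i).integral_eq, hmean]
  have hv : ∀ i, variance (X i) P = σ ^ 2 := fun i => by rw [(hident i).variance_eq, hvar]
  have hs : 0 < √(σ ^ 2) := Real.sqrt_pos.2 hpos
  have hss : √(σ ^ 2) ^ 2 = σ ^ 2 := Real.sq_sqrt hpos.le
  set Y : ℕ → Ω → ℝ := fun i ω => (X i ω - μ) / √(σ ^ 2) with hY
  have hu : Measurable fun x : ℝ => (x - μ) / √(σ ^ 2) := by fun_prop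
  have hYindep : iIndepFun Y P := hindep.comp (fun _ x => (x - μ) / √(σ ^ 2)) fun _ => hu
  have hYident : ∀ i, IdentDistrib (Y i) (Y 0) P P := fun i =>
    ((hident i).trans (hident 0).symm).comp hu
  have hYL : MemLp (Y 0) 2 P := by
    simp only [hY, div_eq_mul_inv]
    exact ((hL 0).sub (memLp_const μ)).mul_const _
  have hY0 : ∫ ω, Y 0 ω ∂P = 0 := by
    simp only [hY]
    rw [integral_div, integral_sub ((hL 0).integrable one_le_two) (integrable_const _), hm]
    simp
  have hY1 : ∫ ω, Y 0 ω ^ 2 ∂P = 1 := by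
    simp only [hY, div_pow, hss]
    rw [integral_div, ← hv 0, variance_eq_integral (hL 0).aestronglyMeasurable.aemeasurable, hm]
    refine div_self ?_
    rw [← hm 0, ← variance_eq_integral (hL 0).aestronglyMeasurable.aemeasurable, hv]
    exact hpos.ne'
  have hsum : standardizedSampleMean P X
      = fun (n : ℕ) ω => (√n)⁻¹ * ∑ i ∈ Finset.range n, Y i ω := by
    ext n ω
    exact BerryEsseen.standardizedSampleMean_eq_sum hindep hL hm hv hpos n ω
  have hdist : TendstoInDistribution (fun n : ℕ => standardizedSampleMean P X n) atTop Z
      (fun _ => P) P'' := by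
    rw [hsum]
    exact tendstoInDistribution_inv_sqrt_mul_sum hZ hY0 hY1 hYindep hYident
  refine ⟨fun n hn ω => BerryEsseen.standardizedSampleMean_eq hindep hL hm hv hpos hn ω,
    fun z => ⟨?_, BerryEsseen.measureReal_le_of_hasLaw_gaussianReal hZ z⟩, hdist, ?_⟩
  · have := nullSingletonClass_gaussianReal (μ := 0) one_ne_zero
    exact BerryEsseen.tendsto_measureReal_le_of_tendstoInDistribution hdist
      (by rw [hZ.map_eq, measure_singleton])
  · intro h3 n hn z
    rw [hm 0] at h3 ⊢
    have e : (fun ω => |Y 0 ω| ^ 3) = fun ω => |X 0 ω - μ| ^ 3 / √(σ ^ 2) ^ 3 := by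
      ext ω
      rw [hY, abs_div, abs_of_pos hs, div_pow]
    have key := BerryEsseen.abs_measureReal_inv_sqrt_mul_sum_le hYindep hYident hYL hY0 hY1
      (by rw [e]; exact h3.div_const _) hn z
    -- Dividing by the standard deviation scales the third absolute moment by its cube, which is the
    -- variance to the power 3/2.
    have hp : (σ ^ 2) ^ (3 / 2 : ℝ) = √(σ ^ 2) ^ 3 := by
      rw [Real.sqrt_eq_rpow, ← Real.rpow_natCast _ 3, ← Real.rpow_mul hpos.le]
      norm_num
    rw [e, integral_div] at key
    rw [hsum, hv 0, hp]
    refine key.trans_eq ?_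
    rw [div_div, mul_div_assoc]
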